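/- **Notation.** For $p\ge 1$ let $\|\cdot\|_p$ be the $\ell_p$-norm; $v_S$ is the vector $v$ with all entries outside $S$ set to zero; $\sigma_s(x)_1=\inf\{\|x-z\|_1: z \text{ has at most } s \text{ non-zero entries}\}$. A matrix $A\in\mathbb{R}^{m\times n}$ has the $\ell_q$-robust null space property ($\ell_q$-NSP) of order $s$ with parameters $\rho,\tau$ if $\|v_S\|_q\le \rho\, s^{-(1-1/q)}\|v_{S^c}\|_1+\tau\|Av\|_2$ for all $v\in\mathbb{R}^n$ and all $S\subset\{1,\dots,n\}$ with $|S|\le s$. A random vector $X\in\mathbb{R}^d$ is sub-isotropic if $\mathbb{E}\langle X,v\rangle^2\ge\|v\|_2^2$ for all $v\in\mathbb{R}^d$, and $1$-subgaussian if $\mathbb{E}\exp(t\langle X,v\rangle)\le\exp(t^2)$ for all $t\in\mathbb{R}$ and all $v\in\mathbb{R}^d$ with $\|v\|_2\le 1$. A solution of the non-negative least squares problem (NNLS) for $y\in\mathbb{R}^m$ is a minimizer of $\|y-Ax\|_2$ over all $x\in\mathbb{R}^n$ with non-negative entries. **Theorem.** Let $\rho\in(0,1/3)$ and $q\in[2,\infty)$,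 and let $1\le s\le n$ and $m$ be integers with $$m\ \ge\ \frac{2\cdot 384^2}{\rho^2}\,s^{2-2/q}\Big(2+\sqrt{\log(en/s)}\Big)^2+1 .$$ Then there is a number $\tau>0$, depending only on $\rho,q,m,n,s$, with $$\frac1\tau\ \ge\ \frac{\sqrt{m-1}}{16}-\frac{3s^{1-1/q}}{\rho}\,8\sqrt2\,\Big(2+\sqrt{\log(en/s)}\Big),$$ such that the following holds. Let $\mu>0$ and let $A\in\mathbb{R}^{m\times n}$ be a random matrix with rows $a_i=a_{0,i}+\mu\mathbf 1^T$, where $a_{0,1},\dots,a_{0,m}$ are independent copies of a sub-isotropic and $1$-subgaussian random vector $a_0\in\mathbb{R}^n$, and suppose that the columns of the matrix with rows $a_{0,i}$ are $1$-subgaussian random vectors in $\mathbb{R}^m$ as well. Put $W=\operatorname{diag}(A^Tt)$ with $t=\frac1{m\mu}\mathbf 1\in\mathbb{R}^m$, $\kappa=\|W\|\,\|W^{-1}\|$ (spectral norms), and $$C=2\,\frac{\kappa(1+\kappa\rho)^2}{1-\kappa\rho},\qquad D=2\,\frac{3+\kappa\rho}{1-\kappa\rho}\max\{\kappa,\|W^{-1}\|\}.$$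 Then, with probability at least $$1-e^{-(m-1)/64}-2n\exp\!\Big(-\frac{\mu^2m}{16}\Big),$$ $A$ has the $\ell_q$-NSP of order $s$ with parameters $\rho$ and $\tau$, all entries of $A^Tt$ are positive, $\kappa<3$ and $\|W^{-1}\|<2$, and for every $p\in[1,q]$, every $x_0\in\mathbb{R}^n$ with non-negative entries and every $\mathbf n\in\mathbb{R}^m$, each solution $\hat x$ of the NNLS for $y=Ax_0+\mathbf n$ satisfies $$\|\hat x-x_0\|_p\ \le\ \frac{C}{s^{1-1/p}}\,\sigma_s(x_0)_1+\frac{D}{s^{1/q-1/p}}\Big(\frac{1}{\sqrt m\,\mu}+\tau\Big)\|\mathbf n\|_2 .$$ -/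

import Mathlib

open MeasureTheory ProbabilityTheory

namespace BiasedNNLS

noncomputable section

/-- The `ℓ_p`-norm of a vector in `ℝ^ι`, for a real exponent `p ≥ 1`. -/
def ellNorm {ι : Type*} [Fintype ι] (p : ℝ) (x : ι → ℝ) : ℝ :=
  ‖(WithLp.toLp (ENNReal.ofReal p) x : PiLp (ENNReal.ofReal p) (fun _ : ι => ℝ))‖

theorem ellNorm_eq_sum {ι : Type*} [Fintype ι] {p : ℝ} (hp : 0 < p) (x : ι → ℝ) :
    ellNorm p x = (∑ i, |x i| ^ p) ^ (1 / p) := by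
  have h : (ENNReal.ofReal p).toReal = p := ENNReal.toReal_ofReal hp.le
  unfold ellNorm
  rw [PiLp.norm_eq_sum (by rw [h]; exact hp), h]
  simp [Real.norm_eq_abs]

/-- The error `σ_s(x)_p` of the best `s`-term approximation of `x` in the `ℓ_p`-norm. -/
def bestApproxError {n : ℕ} (s : ℕ) (p : ℝ) (x : Fin n → ℝ) : ℝ :=
  ⨅ z : {z : Fin n → ℝ // (Finset.univ.filter fun i => z i ≠ 0).card ≤ s}, ellNorm p (x - z.1)

/-- The `ℓ_q`-robust null space property of order `s` with respect to the `ℓ₂`-norm, with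
parameters `ρ` and `τ`; `(S : Set _).indicator v` is the vector `v_S`. -/
def NullSpaceProperty {m n : ℕ} (A : Matrix (Fin m) (Fin n) ℝ) (q : ℝ) (s : ℕ) (ρ τ : ℝ) : Prop :=
  ∀ (v : Fin n → ℝ) (S : Finset (Fin n)), S.card ≤ s →
    ellNorm q ((S : Set (Fin n)).indicator v) ≤
      ρ / (s : ℝ) ^ (1 - 1 / q) * ellNorm 1 ((S : Set (Fin n))ᶜ.indicator v)
        + τ * ellNorm 2 (A.mulVec v)

/-- `x` is a solution of the non-negative least squares problem
`min ‖y - A x‖₂` over the vectors `x` with non-negative coordinates. -/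
def IsNNLSSolution {m n : ℕ} (A : Matrix (Fin m) (Fin n) ℝ) (y : Fin m → ℝ)
    (x : Fin n → ℝ) : Prop :=
  (∀ i, 0 ≤ x i) ∧
    ∀ z : Fin n → ℝ, (∀ i, 0 ≤ z i) → ellNorm 2 (y - A.mulVec x) ≤ ellNorm 2 (y - A.mulVec z)

/-- The spectral norm (the operator norm with respect to the Euclidean norm). -/
def specNorm {n : ℕ} (M : Matrix (Fin n) (Fin n) ℝ) : ℝ :=
  ‖Matrix.toEuclideanCLM (n := Fin n) (𝕜 := ℝ) M‖

/-- The diagonal matrix `W = diag(Aᵀ t)`. -/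
def weight {m n : ℕ} (A : Matrix (Fin m) (Fin n) ℝ) (t : Fin m → ℝ) : Matrix (Fin n) (Fin n) ℝ :=
  Matrix.diagonal (A.transpose.mulVec t)

/-- The condition number `κ = ‖W‖ ‖W⁻¹‖` of `W = diag(Aᵀ t)`. -/
def condNumber {m n : ℕ} (A : Matrix (Fin m) (Fin n) ℝ) (t : Fin m → ℝ) : ℝ :=
  specNorm (weight A t) * specNorm (weight A t)⁻¹

/-- `C = 2 κ (1 + κ ρ)² / (1 - κ ρ)`. -/
def constC (κ ρ : ℝ) : ℝ :=
  2 * (κ * (1 + κ * ρ) ^ 2 / (1 - κ * ρ))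

/-- `D = 2 (3 + κ ρ) / (1 - κ ρ) · max {κ, ‖W⁻¹‖}`, where `w` stands for `‖W⁻¹‖`. -/
def constD (κ ρ w : ℝ) : ℝ :=
  2 * ((3 + κ * ρ) / (1 - κ * ρ)) * max κ w

/-- A sub-isotropic random vector: `E ⟨X, v⟩² ≥ ‖v‖₂²` for all `v`. -/
def IsSubIsotropic {Ω : Type*} [MeasurableSpace Ω] (P : Measure Ω) {d : ℕ}
    (X : Ω → EuclideanSpace ℝ (Fin d)) : Prop :=
  ∀ v : EuclideanSpace ℝ (Fin d), ‖v‖ ^ 2 ≤ ∫ ω, (inner ℝ (X ω) v) ^ 2 ∂P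

/-- A `1`-subgaussian random vector: `E exp (t ⟨X, v⟩) ≤ exp (t²)`, the expectation being finite,
for all `v` with `‖v‖₂² ≤ 1` and all real `t`. -/
def IsOneSubgaussian {Ω : Type*} [MeasurableSpace Ω] (P : Measure Ω) {d : ℕ}
    (X : Ω → EuclideanSpace ℝ (Fin d)) : Prop :=
  ∀ v : EuclideanSpace ℝ (Fin d), ‖v‖ ^ 2 ≤ 1 → ∀ t : ℝ,
    Integrable (fun ω => Real.exp (t * inner ℝ (X ω) v)) P ∧
      ∫ ω, Real.exp (t * inner ℝ (X ω) v) ∂P ≤ Real.exp (t ^ 2)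

/-- The `m × n` matrix with rows `a i + μ 1`. -/
def biasedMatrix {m n : ℕ} (a : Fin m → EuclideanSpace ℝ (Fin n)) (μ : ℝ) :
    Matrix (Fin m) (Fin n) ℝ :=
  Matrix.of fun i j => a i j + μ

/-- The `j`-th column of the `m × n` matrix with rows `a i`. -/
def column {m n : ℕ} (a : Fin m → EuclideanSpace ℝ (Fin n)) (j : Fin n) :
    EuclideanSpace ℝ (Fin m) :=
  WithLp.toLp 2 fun i => a i j

end

end BiasedNNLS

open BiasedNNLS

/-!
Normalized differences of disjoint pairs of rows do not see the bias `μ 1` and are again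
independent, sub-isotropic and `1`-subgaussian, so `‖A v‖₂²` dominates a sum of about `m / 2`
squares `⟨φ_i, v⟩²` with `φ_i` of this kind. For a fixed `v` such a sum is at least a constant
multiple of `m ‖v‖₂²` up to exponentially small probability. A union bound gives this for all sums
of `N` signed unit vectors at once, and Maurey's empirical method passes from these to all `v`
whose `ℓ₁`-norm is small compared with the `ℓ₂`-norm. Vectors that could violate the null space
inequality are of this form.

The entries of `Aᵀ t` are `1` plus a centered average, hence lie in `(1/2, 3/2)` by Hoeffding's
inequality and a union bound. For non-negative `x` and `z` one has
`‖W z‖₁ - ‖W x‖₁ = ⟨t, A (z - x)⟩`: an NNLS solution `z` has almost the same weighted `ℓ₁`-norm as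
`x`, and the null space property of `A W⁻¹` turns this into the error bound.
-/

namespace BiasedNNLS

section Norms

variable {ι : Type*} [Fintype ι]

theorem ellNorm_nonneg {p : ℝ} (hp : 0 < p) (x : ι → ℝ) : 0 ≤ ellNorm p x := by
  rw [ellNorm_eq_sum hp]; positivity

theorem ellNorm_rpow {p : ℝ} (hp : 0 < p) (x : ι → ℝ) : ellNorm p x ^ p = ∑ i, |x i| ^ p := by
  rw [ellNorm_eq_sum hp, ← Real.rpow_mul (by positivity), one_div_mul_cancel hp.ne', Real.rpow_one]

theorem ellNorm_one (x : ι → ℝ) : ellNorm 1 x = ∑ i, |x i| := by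
  simp [ellNorm_eq_sum one_pos]

theorem ellNorm_two_sq (x : ι → ℝ) : ellNorm 2 x ^ 2 = ∑ i, x i ^ 2 := by
  simpa using ellNorm_rpow two_pos x

theorem ellNorm_add_le {p : ℝ} (hp : 1 ≤ p) (x y : ι → ℝ) :
    ellNorm p (x + y) ≤ ellNorm p x + ellNorm p y := by
  have : Fact (1 ≤ ENNReal.ofReal p) := ⟨by simpa using hp⟩
  exact norm_add_le _ _

theorem ellNorm_smul {p : ℝ} (hp : 1 ≤ p) (c : ℝ) (x : ι → ℝ) :
    ellNorm p (c • x) = |c| * ellNorm p x := by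
  have : Fact (1 ≤ ENNReal.ofReal p) := ⟨by simpa using hp⟩
  exact norm_smul c (WithLp.toLp (ENNReal.ofReal p) x)

theorem ellNorm_neg {p : ℝ} (hp : 1 ≤ p) (x : ι → ℝ) : ellNorm p (-x) = ellNorm p x := by
  simpa using ellNorm_smul hp (-1) x

theorem ellNorm_mono {p : ℝ} (hp : 0 < p) {x y : ι → ℝ} (h : ∀ i, |x i| ≤ |y i|) :
    ellNorm p x ≤ ellNorm p y := by
  rw [ellNorm_eq_sum hp, ellNorm_eq_sum hp]
  gcongr (∑ i, ?_ ^ _) ^ _ with i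
  exact h i

theorem ellNorm_indicator_le {p : ℝ} (hp : 0 < p) (S : Set ι) (x : ι → ℝ) :
    ellNorm p (S.indicator x) ≤ ellNorm p x :=
  ellNorm_mono hp fun i => norm_indicator_le_norm_self x i

theorem ellNorm_mul_le {p : ℝ} (hp : 1 ≤ p) (d x : ι → ℝ) :
    ellNorm p (d * x) ≤ ‖d‖ * ellNorm p x := by
  calc ellNorm p (d * x) ≤ ellNorm p (‖d‖ • x) := ellNorm_mono (by linarith) fun i => by
        simpa [abs_mul] using mul_le_mul_of_nonneg_right (norm_le_pi_norm d i) (abs_nonneg (x i))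
    _ = ‖d‖ * ellNorm p x := by rw [ellNorm_smul hp, abs_norm]

theorem ellNorm_indicator_mul_le {p : ℝ} (hp : 1 ≤ p) (S : Set ι) (d x : ι → ℝ) :
    ellNorm p (S.indicator (d * x)) ≤ ‖d‖ * ellNorm p (S.indicator x) := by
  have h : S.indicator (d * x) = d * S.indicator x :=
    funext fun i => S.indicator_mul_right d x
  exact h ▸ ellNorm_mul_le hp d _

theorem abs_le_ellNorm {p : ℝ} (hp : 0 < p) (x : ι → ℝ) (i : ι) : |x i| ≤ ellNorm p x := by
  refine (Real.rpow_le_rpow_iff (abs_nonneg _) (ellNorm_nonneg hp x) hp).1 ?_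
  rw [ellNorm_rpow hp]
  exact Finset.single_le_sum (f := fun i => |x i| ^ p) (fun i _ => by positivity)
    (Finset.mem_univ i)

theorem ellNorm_rpow_le_of_abs_le {p q M : ℝ} (hp : 0 < p) (hpq : p ≤ q) {x : ι → ℝ}
    (hM : ∀ i, |x i| ≤ M) : ellNorm q x ^ q ≤ M ^ (q - p) * ellNorm p x ^ p := by
  rw [ellNorm_rpow (hp.trans_le hpq), ellNorm_rpow hp, Finset.mul_sum]
  refine Finset.sum_le_sum fun i _ => ?_
  calc |x i| ^ q = |x i| ^ (q - p) * |x i| ^ p := by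
        rw [← Real.rpow_add_of_nonneg (abs_nonneg _) (sub_nonneg.2 hpq) hp.le, sub_add_cancel]
    _ ≤ M ^ (q - p) * |x i| ^ p := by
        gcongr
        exact hM i

theorem ellNorm_antitone {p q : ℝ} (hp : 0 < p) (hpq : p ≤ q) (x : ι → ℝ) :
    ellNorm q x ≤ ellNorm p x := by
  have hq := hp.trans_le hpq
  have hx := ellNorm_nonneg hp x
  refine (Real.rpow_le_rpow_iff (ellNorm_nonneg hq x) hx hq).1 ?_
  calc ellNorm q x ^ q ≤ ellNorm p x ^ (q - p) * ellNorm p x ^ p :=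
        ellNorm_rpow_le_of_abs_le hp hpq (abs_le_ellNorm hp x)
    _ = ellNorm p x ^ q := by
        rw [← Real.rpow_add_of_nonneg hx (sub_nonneg.2 hpq) hp.le, sub_add_cancel]

theorem ellNorm_indicator_rpow {p : ℝ} (hp : 0 < p) (S : Finset ι) (x : ι → ℝ) :
    ellNorm p ((S : Set ι).indicator x) ^ p = ∑ i ∈ S, |x i| ^ p := by
  classical
  rw [ellNorm_rpow hp, ← Finset.sum_subset (Finset.subset_univ S)]
  · exact Finset.sum_congr rfl fun i hi => by simp [hi]
  · intro i _ hi
    simp [hi, Real.zero_rpow hp.ne']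

theorem ellNorm_indicator_le_card {p q : ℝ} (hp : 0 < p) (hpq : p ≤ q) {s : ℕ}
    (S : Finset ι) (hS : S.card ≤ s) (x : ι → ℝ) :
    ellNorm p ((S : Set ι).indicator x) ≤
      (s : ℝ) ^ (1 / p - 1 / q) * ellNorm q ((S : Set ι).indicator x) := by
  have hq := hp.trans_le hpq
  have hNq := ellNorm_nonneg hq ((S : Set ι).indicator x)
  refine (Real.rpow_le_rpow_iff (ellNorm_nonneg hp _) (by positivity) hq).1 ?_
  have hpow (i : ι) : (|x i| ^ p) ^ (q / p) = |x i| ^ q := by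
    rw [← Real.rpow_mul (abs_nonneg _), mul_div_cancel₀ _ hp.ne']
  calc ellNorm p ((S : Set ι).indicator x) ^ q = (∑ i ∈ S, |x i| ^ p) ^ (q / p) := by
        rw [← ellNorm_indicator_rpow hp, ← Real.rpow_mul (ellNorm_nonneg hp _),
          mul_div_cancel₀ _ hp.ne']
    _ ≤ (S.card : ℝ) ^ (q / p - 1) * ∑ i ∈ S, (|x i| ^ p) ^ (q / p) :=
        Real.rpow_sum_le_const_mul_sum_rpow_of_nonneg S ((one_le_div hp).2 hpq)
          fun i _ => by positivity
    _ = (S.card : ℝ) ^ (q / p - 1) * ellNorm q ((S : Set ι).indicator x) ^ q := by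
        simp_rw [hpow, ellNorm_indicator_rpow hq]
    _ ≤ (s : ℝ) ^ (q / p - 1) * ellNorm q ((S : Set ι).indicator x) ^ q := by
        gcongr
        exact sub_nonneg.2 ((one_le_div hp).2 hpq)
    _ = ((s : ℝ) ^ (1 / p - 1 / q) * ellNorm q ((S : Set ι).indicator x)) ^ q := by
        rw [Real.mul_rpow (by positivity) hNq, ← Real.rpow_mul (by positivity)]
        congr 2
        field_simp

theorem ellNorm_one_eq_add_compl (S : Set ι) (x : ι → ℝ) :
    ellNorm 1 x = ellNorm 1 (S.indicator x) + ellNorm 1 (Sᶜ.indicator x) := by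
  classical
  simp only [ellNorm_one, ← Finset.sum_add_distrib]
  refine Finset.sum_congr rfl fun i _ => ?_
  by_cases h : i ∈ S <;> simp [h]

theorem ellNorm_le_add_compl {p : ℝ} (hp : 1 ≤ p) (S : Set ι) (x : ι → ℝ) :
    ellNorm p x ≤ ellNorm p (S.indicator x) + ellNorm p (Sᶜ.indicator x) := by
  simpa only [Set.indicator_self_add_compl] using
    ellNorm_add_le hp (S.indicator x) (Sᶜ.indicator x)

theorem exists_card_eq_forall_notMem_le {α : Type*} [LinearOrder α] (f : ι → α) {s : ℕ}
    (hs : s ≤ Fintype.card ι) :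
    ∃ S : Finset ι, S.card = s ∧ ∀ i ∈ S, ∀ j ∉ S, f j ≤ f i := by
  classical
  induction s with
  | zero => exact ⟨∅, by simp⟩
  | succ s ih =>
    obtain ⟨S, hS, h⟩ := ih (by omega)
    have hne : Sᶜ.Nonempty := by
      rw [← Finset.card_pos, Finset.card_compl]
      omega
    obtain ⟨a, ha, hmax⟩ := Finset.exists_max_image _ f hne
    simp only [Finset.mem_compl] at ha hmax
    refine ⟨insert a S, by simp [ha, hS], fun i hi j hj => ?_⟩
    simp only [Finset.mem_insert, not_or] at hi hj
    rcases hi with rfl | hi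
    exacts [hmax j hj.2, h i hi j hj.2]

theorem ellNorm_compl_le_of_forall_notMem_le {p q : ℝ} (hp : 0 < p) (hpq : p ≤ q)
    {S : Finset ι} (hS : S.Nonempty) {x : ι → ℝ} (h : ∀ i ∈ S, ∀ j ∉ S, |x j| ≤ |x i|) :
    ellNorm q ((S : Set ι)ᶜ.indicator x) ≤ ellNorm p x / (S.card : ℝ) ^ (1 / p - 1 / q) := by
  have hq := hp.trans_le hpq
  have hs : (0 : ℝ) < S.card := by exact_mod_cast hS.card_pos
  have hN := ellNorm_nonneg hp x
  set M := ellNorm p x / (S.card : ℝ) ^ (1 / p) with hM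
  have hM0 : 0 ≤ M := by positivity
  have hMp : M ^ p = ellNorm p x ^ p / S.card := by
    rw [hM, Real.div_rpow hN (by positivity), ← Real.rpow_mul hs.le, one_div_mul_cancel hp.ne',
      Real.rpow_one]
  have hsmall (j : ι) : |(S : Set ι)ᶜ.indicator x j| ≤ M := by
    by_cases hj : j ∈ S
    · simpa [hj] using hM0
    suffices |x j| ^ p * S.card ≤ ellNorm p x ^ p by
      simpa [hj, ← Real.rpow_le_rpow_iff (abs_nonneg (x j)) hM0 hp, hMp, le_div_iff₀ hs]
    calc |x j| ^ p * S.card = ∑ _i ∈ S, |x j| ^ p := by simp [mul_comm]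
      _ ≤ ∑ i ∈ S, |x i| ^ p := by
          gcongr ∑ i ∈ S, ?_ ^ p with i hi
          exact h i hi j hj
      _ ≤ ∑ i, |x i| ^ p := Finset.sum_le_univ_sum_of_nonneg fun i => by positivity
      _ = ellNorm p x ^ p := (ellNorm_rpow hp x).symm
  refine (Real.rpow_le_rpow_iff (ellNorm_nonneg hq _) (by positivity) hq).1 ?_
  calc ellNorm q ((S : Set ι)ᶜ.indicator x) ^ q
      ≤ M ^ (q - p) * ellNorm p ((S : Set ι)ᶜ.indicator x) ^ p :=
        ellNorm_rpow_le_of_abs_le hp hpq hsmall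
    _ ≤ M ^ (q - p) * (M ^ p * S.card) := by
        rw [hMp, div_mul_cancel₀ _ hs.ne']
        gcongr
        exacts [ellNorm_nonneg hp _, ellNorm_indicator_le hp _ x]
    _ = M ^ q * S.card := by
        rw [← mul_assoc, ← Real.rpow_add_of_nonneg hM0 (sub_nonneg.2 hpq) hp.le, sub_add_cancel]
    _ = (ellNorm p x / (S.card : ℝ) ^ (1 / p - 1 / q)) ^ q := by
        have hcard : (S.card : ℝ) ^ (1 / p) =
            (S.card : ℝ) ^ (1 / p - 1 / q) * (S.card : ℝ) ^ (1 / q) := by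
          rw [← Real.rpow_add hs, sub_add_cancel]
        rw [hM, hcard, ← div_div, Real.div_rpow (by positivity) (by positivity),
          ← Real.rpow_mul hs.le, one_div_mul_cancel hq.ne', Real.rpow_one, div_mul_cancel₀ _ hs.ne']

theorem exists_ellNorm_compl_le_bestApproxError {n : ℕ} (s : ℕ) {p : ℝ} (hp : 0 < p)
    (x : Fin n → ℝ) :
    ∃ S : Finset (Fin n), S.card ≤ s ∧
      ellNorm p ((S : Set (Fin n))ᶜ.indicator x) ≤ bestApproxError s p x := by
  obtain ⟨S, hS, hmin⟩ := Finset.exists_min_image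
    (Finset.univ.filter fun S : Finset (Fin n) => S.card ≤ s)
    (fun S => ellNorm p ((S : Set (Fin n))ᶜ.indicator x)) ⟨∅, by simp⟩
  simp only [Finset.mem_filter_univ] at hS hmin
  have : Nonempty {z : Fin n → ℝ // (Finset.univ.filter fun i => z i ≠ 0).card ≤ s} :=
    ⟨⟨0, by simp⟩⟩
  refine ⟨S, hS, le_ciInf fun z => (hmin _ z.2).trans (ellNorm_mono hp fun i => ?_)⟩
  by_cases h : z.1 i = 0 <;> simp [h]

end Norms

section NullSpaceBound

variable {ι : Type*} [Fintype ι]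

/-- The inequality of the `ℓ_q`-robust null space property for a single vector `v`, with `η` in
place of `τ ‖A v‖₂`. It is meant for vectors such as `d * v`, with fixed weights `d`, whose defect
`η` comes from measurements of `v` itself. -/
def NullSpaceBound (v : ι → ℝ) (q : ℝ) (s : ℕ) (ρ η : ℝ) : Prop :=
  ∀ S : Finset ι, S.card ≤ s → ellNorm q ((S : Set ι).indicator v) ≤
    ρ / (s : ℝ) ^ (1 - 1 / q) * ellNorm 1 ((S : Set ι)ᶜ.indicator v) + η

variable {p q ρ η : ℝ} {s : ℕ} {v x z d : ι → ℝ} {S : Finset ι}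

theorem NullSpaceBound.mul (h : NullSpaceBound v q s ρ η) (hq : 1 ≤ q) (hρ : 0 ≤ ρ)
    (hd : ∀ i, d i ≠ 0) : NullSpaceBound (d * v) q s (‖d‖ * ‖d⁻¹‖ * ρ) (‖d‖ * η) := by
  intro S hS
  have hcancel : d⁻¹ * (d * v) = v := by
    ext i
    simp [hd i]
  calc ellNorm q ((S : Set ι).indicator (d * v))
      ≤ ‖d‖ * ellNorm q ((S : Set ι).indicator v) := ellNorm_indicator_mul_le hq _ d v
    _ ≤ ‖d‖ * (ρ / (s : ℝ) ^ (1 - 1 / q) *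
          ellNorm 1 ((S : Set ι)ᶜ.indicator (d⁻¹ * (d * v))) + η) := by
        rw [hcancel]
        gcongr
        exact h S hS
    _ ≤ ‖d‖ * (ρ / (s : ℝ) ^ (1 - 1 / q) *
          (‖d⁻¹‖ * ellNorm 1 ((S : Set ι)ᶜ.indicator (d * v))) + η) := by
        gcongr
        exact ellNorm_indicator_mul_le le_rfl _ _ _
    _ = _ := by ring

theorem NullSpaceBound.of_le (h : NullSpaceBound v q s ρ η) (hs : 0 < s) (hp : 0 < p)
    (hpq : p ≤ q) : NullSpaceBound v p s ρ ((s : ℝ) ^ (1 / p - 1 / q) * η) := by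
  intro S hS
  have hs0 : (0 : ℝ) < s := by exact_mod_cast hs
  have hexp : (s : ℝ) ^ (1 - 1 / q) = (s : ℝ) ^ (1 / p - 1 / q) * (s : ℝ) ^ (1 - 1 / p) := by
    rw [← Real.rpow_add hs0]
    congr 1
    ring
  calc ellNorm p ((S : Set ι).indicator v)
      ≤ (s : ℝ) ^ (1 / p - 1 / q) * ellNorm q ((S : Set ι).indicator v) :=
        ellNorm_indicator_le_card hp hpq S hS v
    _ ≤ (s : ℝ) ^ (1 / p - 1 / q) *
          (ρ / (s : ℝ) ^ (1 - 1 / q) * ellNorm 1 ((S : Set ι)ᶜ.indicator v) + η) := by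
        gcongr
        exact h S hS
    _ = _ := by
        rw [hexp]
        field_simp

theorem NullSpaceBound.ellNorm_le (h : NullSpaceBound v p s ρ η) (hp : 1 ≤ p) (hρ : 0 ≤ ρ)
    (hs : 0 < s) (hsn : s ≤ Fintype.card ι) :
    ellNorm p v ≤ (1 + ρ) / (s : ℝ) ^ (1 - 1 / p) * ellNorm 1 v + η := by
  obtain ⟨S, rfl, hmax⟩ := exists_card_eq_forall_notMem_le (fun i => |v i|) hsn
  have htail := ellNorm_compl_le_of_forall_notMem_le one_pos hp (Finset.card_pos.1 hs) hmax
  rw [one_div_one] at htail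
  have hhead : ellNorm p ((S : Set ι).indicator v) ≤
      ρ / (S.card : ℝ) ^ (1 - 1 / p) * ellNorm 1 v + η := by
    refine (h S le_rfl).trans ?_
    gcongr
    exact ellNorm_indicator_le one_pos _ v
  calc ellNorm p v ≤ ellNorm p ((S : Set ι).indicator v) + ellNorm p ((S : Set ι)ᶜ.indicator v) :=
        ellNorm_le_add_compl hp _ v
    _ ≤ (ρ / (S.card : ℝ) ^ (1 - 1 / p) * ellNorm 1 v + η)
          + ellNorm 1 v / (S.card : ℝ) ^ (1 - 1 / p) := add_le_add hhead htail
    _ = (1 + ρ) / (S.card : ℝ) ^ (1 - 1 / p) * ellNorm 1 v + η := by ring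

theorem ellNorm_one_compl_sub_le (S : Set ι) (x z : ι → ℝ) :
    ellNorm 1 (Sᶜ.indicator (z - x)) ≤ ellNorm 1 z - ellNorm 1 x +
      ellNorm 1 (S.indicator (z - x)) + 2 * ellNorm 1 (Sᶜ.indicator x) := by
  classical
  simp only [ellNorm_one, Finset.mul_sum, ← Finset.sum_add_distrib, ← Finset.sum_sub_distrib]
  refine Finset.sum_le_sum fun i _ => ?_
  by_cases hi : i ∈ S
  · have := abs_sub_abs_le_abs_sub (x i) (z i)
    rw [abs_sub_comm] at this
    simpa [hi] using by linarith
  · have := abs_sub (z i) (x i)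
    simpa [hi] using by linarith

theorem NullSpaceBound.ellNorm_one_sub_le (h : NullSpaceBound (z - x) 1 s ρ η) (hS : S.card ≤ s)
    (hρ0 : 0 ≤ ρ) (hρ1 : ρ < 1) :
    ellNorm 1 (z - x) ≤ (1 + ρ) / (1 - ρ) *
        (ellNorm 1 z - ellNorm 1 x + 2 * ellNorm 1 ((S : Set ι)ᶜ.indicator x))
      + 2 / (1 - ρ) * η := by
  have hnsp := h S hS
  have hcompl := ellNorm_one_compl_sub_le S x z
  have hsplit := ellNorm_one_eq_add_compl S (z - x)
  have hρ : 0 < 1 - ρ := by linarith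
  simp only [sub_self, Real.rpow_zero, div_one] at hnsp
  rw [div_mul_eq_mul_div, div_mul_eq_mul_div, ← add_div, le_div_iff₀ hρ]
  nlinarith

theorem NullSpaceBound.ellNorm_sub_le (h : NullSpaceBound (z - x) q s ρ η) (hp : 1 ≤ p)
    (hpq : p ≤ q) (hs : 0 < s) (hsn : s ≤ Fintype.card ι) (hS : S.card ≤ s) (hρ0 : 0 ≤ ρ)
    (hρ1 : ρ < 1) :
    ellNorm p (z - x) ≤ (1 + ρ) ^ 2 / (1 - ρ) / (s : ℝ) ^ (1 - 1 / p) *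
        (ellNorm 1 z - ellNorm 1 x + 2 * ellNorm 1 ((S : Set ι)ᶜ.indicator x))
      + (3 + ρ) / (1 - ρ) / (s : ℝ) ^ (1 / q - 1 / p) * η := by
  have hs0 : (0 : ℝ) < s := by exact_mod_cast hs
  have hρ : 1 - ρ ≠ 0 := by linarith
  have hneg : (s : ℝ) ^ (1 / p - 1 / q) = ((s : ℝ) ^ (1 / q - 1 / p))⁻¹ := by
    rw [← Real.rpow_neg hs0.le, neg_sub]
  have hexp : (s : ℝ) ^ (1 / 1 - 1 / q) = (s : ℝ) ^ (1 - 1 / p) * (s : ℝ) ^ (1 / p - 1 / q) := by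
    rw [← Real.rpow_add hs0]
    congr 1
    ring
  calc ellNorm p (z - x)
      ≤ (1 + ρ) / (s : ℝ) ^ (1 - 1 / p) * ellNorm 1 (z - x) + (s : ℝ) ^ (1 / p - 1 / q) * η :=
        (h.of_le hs (by linarith) hpq).ellNorm_le hp hρ0 hs hsn
    _ ≤ (1 + ρ) / (s : ℝ) ^ (1 - 1 / p) * ((1 + ρ) / (1 - ρ) *
          (ellNorm 1 z - ellNorm 1 x + 2 * ellNorm 1 ((S : Set ι)ᶜ.indicator x))
          + 2 / (1 - ρ) * ((s : ℝ) ^ (1 / 1 - 1 / q) * η)) + (s : ℝ) ^ (1 / p - 1 / q) * η := by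
        gcongr
        exact (h.of_le hs one_pos (hp.trans hpq)).ellNorm_one_sub_le hS hρ0 hρ1
    _ = _ := by
        rw [hexp, hneg]
        field_simp
        ring

end NullSpaceBound

section NNLS

variable {m n : ℕ} {A : Matrix (Fin m) (Fin n) ℝ}

theorem ellNorm_one_mul_of_nonneg {ι : Type*} [Fintype ι] {d x : ι → ℝ} (hd : 0 ≤ d)
    (hx : 0 ≤ x) : ellNorm 1 (d * x) = d ⬝ᵥ x := by
  rw [ellNorm_one]
  exact Finset.sum_congr rfl fun i _ => abs_of_nonneg (mul_nonneg (hd i) (hx i))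

theorem dotProduct_le_ellNorm_mul {ι : Type*} [Fintype ι] (x y : ι → ℝ) :
    x ⬝ᵥ y ≤ ellNorm 2 x * ellNorm 2 y := by
  have hx := ellNorm_nonneg two_pos x
  have hy := ellNorm_nonneg two_pos y
  refine le_of_sq_le_sq ?_ (by positivity)
  rw [mul_pow, ellNorm_two_sq, ellNorm_two_sq]
  exact Finset.sum_mul_sq_le_sq_mul_sq _ _ _

theorem ellNorm_one_transpose_mulVec_mul_sub_le {t : Fin m → ℝ} (hd : 0 ≤ A.transpose.mulVec t)
    {x z : Fin n → ℝ} (hx : 0 ≤ x) (hz : 0 ≤ z) :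
    ellNorm 1 (A.transpose.mulVec t * z) - ellNorm 1 (A.transpose.mulVec t * x) ≤
      ellNorm 2 t * ellNorm 2 (A.mulVec (z - x)) := by
  rw [ellNorm_one_mul_of_nonneg hd hz, ellNorm_one_mul_of_nonneg hd hx, ← dotProduct_sub,
    Matrix.mulVec_transpose, ← Matrix.dotProduct_mulVec]
  exact dotProduct_le_ellNorm_mul _ _

theorem IsNNLSSolution.ellNorm_mulVec_sub_le {x₀ x : Fin n → ℝ} {y : Fin m → ℝ}
    (hx₀ : 0 ≤ x₀) (h : IsNNLSSolution A y x) :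
    ellNorm 2 (A.mulVec (x - x₀)) ≤ 2 * ellNorm 2 (y - A.mulVec x₀) := by
  calc ellNorm 2 (A.mulVec (x - x₀))
      = ellNorm 2 (-(y - A.mulVec x) + (y - A.mulVec x₀)) := by
        rw [Matrix.mulVec_sub]
        abel_nf
    _ ≤ ellNorm 2 (y - A.mulVec x) + ellNorm 2 (y - A.mulVec x₀) := by
        rw [← ellNorm_neg one_le_two (y - A.mulVec x)]
        exact ellNorm_add_le one_le_two _ _
    _ ≤ 2 * ellNorm 2 (y - A.mulVec x₀) := by linarith [h.2 x₀ hx₀]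

theorem specNorm_diagonal (d : Fin n → ℝ) : specNorm (Matrix.diagonal d) = ‖d‖ := by
  open scoped Matrix.Norms.L2Operator in
  rw [specNorm, Matrix.l2_opNorm_toEuclideanCLM, Matrix.l2_opNorm_diagonal]

theorem specNorm_inv_diagonal {d : Fin n → ℝ} (hd : ∀ j, d j ≠ 0) :
    specNorm (Matrix.diagonal d)⁻¹ = ‖d⁻¹‖ := by
  rw [← specNorm_diagonal, Matrix.inv_eq_right_inv (B := Matrix.diagonal d⁻¹)]
  rw [Matrix.diagonal_mul_diagonal, ← Matrix.diagonal_one]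
  congr 1
  ext j
  exact mul_inv_cancel₀ (hd j)

theorem condNumber_eq {t : Fin m → ℝ} (hd : ∀ j, A.transpose.mulVec t j ≠ 0) :
    condNumber A t = ‖A.transpose.mulVec t‖ * ‖(A.transpose.mulVec t)⁻¹‖ := by
  rw [condNumber, weight, specNorm_diagonal, specNorm_inv_diagonal hd]

theorem NullSpaceProperty.ellNorm_mul_sub_le {p q ρ τ : ℝ} {s : ℕ}
    (hA : NullSpaceProperty A q s ρ τ) {t : Fin m → ℝ} {d : Fin n → ℝ}
    (hdt : A.transpose.mulVec t = d) (hd : ∀ j, 0 < d j) (hρ : 0 ≤ ρ)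
    (hκ : ‖d‖ * ‖d⁻¹‖ * ρ < 1) (hs : 0 < s) (hsn : s ≤ n) (hp : 1 ≤ p) (hpq : p ≤ q)
    {x z : Fin n → ℝ} (hx : 0 ≤ x) (hz : 0 ≤ z) :
    ellNorm p (d * (z - x)) ≤
      (1 + ‖d‖ * ‖d⁻¹‖ * ρ) ^ 2 / (1 - ‖d‖ * ‖d⁻¹‖ * ρ) / (s : ℝ) ^ (1 - 1 / p) *
          (ellNorm 2 t * ellNorm 2 (A.mulVec (z - x)) + 2 * (‖d‖ * bestApproxError s 1 x))
        + (3 + ‖d‖ * ‖d⁻¹‖ * ρ) / (1 - ‖d‖ * ‖d⁻¹‖ * ρ) / (s : ℝ) ^ (1 / q - 1 / p) *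
          (‖d‖ * (τ * ellNorm 2 (A.mulVec (z - x)))) := by
  subst hdt
  have hd0 (j : Fin n) := (hd j).ne'
  have hwt := ellNorm_one_transpose_mulVec_mul_sub_le (fun j => (hd j).le) hx hz
  set d := A.transpose.mulVec t
  obtain ⟨S, hS, hσ⟩ := exists_ellNorm_compl_le_bestApproxError s one_pos x
  have hnsp := NullSpaceBound.mul (hA (z - x)) (hp.trans hpq) hρ hd0
  rw [mul_sub] at hnsp ⊢
  have htail : ellNorm 1 ((S : Set (Fin n))ᶜ.indicator (d * x)) ≤ ‖d‖ * bestApproxError s 1 x :=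
    (ellNorm_indicator_mul_le le_rfl _ _ _).trans (by gcongr)
  have : 0 < 1 - ‖d‖ * ‖d⁻¹‖ * ρ := by linarith
  refine (hnsp.ellNorm_sub_le hp hpq hs (by simpa using hsn) hS (by positivity) hκ).trans ?_
  gcongr

theorem noise_coefficient_le {κ r w a b T τ : ℝ} (hr0 : 0 ≤ r) (hr1 : r < 1) (hw : 0 ≤ w)
    (hb : 0 < b) (hab : b ≤ a) (hT : 0 ≤ T) (hτ : 0 ≤ τ) :
    w * ((1 + r) ^ 2 / (1 - r) / a * T) + (3 + r) / (1 - r) / b * κ * τ ≤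
      (3 + r) / (1 - r) * max κ w / b * (T + τ) := by
  have : 0 < 1 - r := by linarith
  have ha : 0 < a := hb.trans_le hab
  have hsq : (1 + r) ^ 2 ≤ 3 + r := by nlinarith
  calc _ ≤ max κ w * ((3 + r) / (1 - r) / b * T) + (3 + r) / (1 - r) / b * max κ w * τ := by
        gcongr
        exacts [le_max_right κ w, le_max_left κ w]
    _ = _ := by ring

theorem NullSpaceProperty.nnls_error_le {p q ρ τ : ℝ} {s : ℕ} (hA : NullSpaceProperty A q s ρ τ)
    {t : Fin m → ℝ} (hd : ∀ j, 0 < A.transpose.mulVec t j) (hρ : 0 ≤ ρ)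
    (hκ : condNumber A t * ρ < 1) (hτ : 0 ≤ τ) (hs : 0 < s) (hsn : s ≤ n) (hp : 1 ≤ p)
    (hpq : p ≤ q) {x₀ x : Fin n → ℝ} (hx₀ : 0 ≤ x₀) {y : Fin m → ℝ} (hx : IsNNLSSolution A y x) :
    ellNorm p (x - x₀) ≤
      constC (condNumber A t) ρ / (s : ℝ) ^ (1 - 1 / p) * bestApproxError s 1 x₀
        + constD (condNumber A t) ρ (specNorm (weight A t)⁻¹) / (s : ℝ) ^ (1 / q - 1 / p)
          * (ellNorm 2 t + τ) * ellNorm 2 (y - A.mulVec x₀) := by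
  have hd0 (j : Fin n) := (hd j).ne'
  have hw : specNorm (weight A t)⁻¹ = ‖(A.transpose.mulVec t)⁻¹‖ := specNorm_inv_diagonal hd0
  have hε := hx.ellNorm_mulVec_sub_le hx₀
  rw [condNumber_eq hd0] at hκ
  have hweighted := hA.ellNorm_mul_sub_le rfl hd hρ hκ hs hsn hp hpq hx₀ hx.1
  rw [constC, constD, hw, condNumber_eq hd0]
  set d := A.transpose.mulVec t
  set r := ‖d‖ * ‖d⁻¹‖ * ρ
  set ε := ellNorm 2 (A.mulVec (x - x₀))
  set a := (s : ℝ) ^ (1 - 1 / p)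
  set b := (s : ℝ) ^ (1 / q - 1 / p)
  have : (0 : ℝ) < s := by exact_mod_cast hs
  have hr0 : 0 ≤ r := by positivity
  have hb : 0 < b := by positivity
  have hba : b ≤ a := by
    have hq : 1 / q ≤ 1 := (div_le_one (by linarith)).2 (hp.trans hpq)
    exact Real.rpow_le_rpow_of_exponent_le (by exact_mod_cast hs) (by linarith)
  calc ellNorm p (x - x₀) = ellNorm p (d⁻¹ * (d * (x - x₀))) := by
        congr 1
        ext j
        simp [hd0 j]
    _ ≤ ‖d⁻¹‖ * ((1 + r) ^ 2 / (1 - r) / a * (ellNorm 2 t * ε + 2 * (‖d‖ * bestApproxError s 1 x₀))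
          + (3 + r) / (1 - r) / b * (‖d‖ * (τ * ε))) :=
        (ellNorm_mul_le hp _ _).trans (by gcongr)
    _ = 2 * (‖d‖ * ‖d⁻¹‖ * (1 + r) ^ 2 / (1 - r)) / a * bestApproxError s 1 x₀
          + (‖d⁻¹‖ * ((1 + r) ^ 2 / (1 - r) / a * ellNorm 2 t)
            + (3 + r) / (1 - r) / b * (‖d‖ * ‖d⁻¹‖) * τ) * ε := by ring
    _ ≤ 2 * (‖d‖ * ‖d⁻¹‖ * (1 + r) ^ 2 / (1 - r)) / a * bestApproxError s 1 x₀
          + ((3 + r) / (1 - r) * max (‖d‖ * ‖d⁻¹‖) ‖d⁻¹‖ / b * (ellNorm 2 t + τ))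
            * (2 * ellNorm 2 (y - A.mulVec x₀)) := by
        have hε0 : 0 ≤ ε := ellNorm_nonneg two_pos _
        have hT := ellNorm_nonneg two_pos t
        have : 0 < 1 - r := sub_pos.2 hκ
        gcongr
        exact noise_coefficient_le hr0 hκ (norm_nonneg _) hb hba hT hτ
    _ = _ := by ring

end NNLS

section SubgaussianSquares

variable {Ω : Type*} [MeasurableSpace Ω] {P : Measure Ω} {X : Ω → ℝ}

theorem one_add_mul_integral_le_mgf [IsProbabilityMeasure P] {t : ℝ} (hX : Integrable X P)
    (hexp : Integrable (fun ω => Real.exp (t * X ω)) P) : 1 + t * ∫ ω, X ω ∂P ≤ mgf X P t :=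
  calc 1 + t * ∫ ω, X ω ∂P = ∫ ω, (t * X ω + 1) ∂P := by
        rw [integral_add (hX.const_mul t) (integrable_const 1), integral_const_mul]
        simp [add_comm]
    _ ≤ mgf X P t :=
        integral_mono ((hX.const_mul t).add (integrable_const 1)) hexp fun ω =>
          Real.add_one_le_exp _

-- Otherwise `1 + t E X ≤ exp (c t² / 2)`, an equality at `t = 0`, would fail for small `t`.
theorem integral_eq_zero_of_hasSubgaussianMGF [IsProbabilityMeasure P] {c : NNReal}
    (hX : HasSubgaussianMGF X c P) : ∫ ω, X ω ∂P = 0 := by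
  set M := ∫ ω, X ω ∂P
  let g : ℝ → ℝ := fun t => Real.exp (c * t ^ 2 / 2) - (1 + t * M)
  have hg_nonneg (t : ℝ) : 0 ≤ g t := sub_nonneg.2 <|
    (one_add_mul_integral_le_mgf hX.integrable (hX.integrable_exp_mul t)).trans (hX.mgf_le t)
  have hg_zero : g 0 = 0 := by simp [g]
  have hg_min : IsLocalMin g 0 := Filter.Eventually.of_forall fun t => by
    rw [hg_zero]
    exact hg_nonneg t
  have hg_deriv : HasDerivAt g (-M) 0 := by
    have hexp := (((hasDerivAt_id (0 : ℝ)).pow 2).const_mul (c : ℝ)).div_const 2 |>.exp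
    have hlin := ((hasDerivAt_id (0 : ℝ)).mul_const M).const_add 1
    refine (hexp.sub hlin).congr_deriv ?_
    simp
  exact neg_eq_zero.1 (hg_min.hasDerivAt_eq_zero hg_deriv)

theorem sq_le_min_add_exp (x : ℝ) :
    x ^ 2 ≤ min (x ^ 2) (25 / 2) +
      2 * Real.exp (-7) * (Real.exp (2 * x) + Real.exp (-(2 * x))) := by
  rcases le_total (x ^ 2) (25 / 2) with hsmall | hlarge
  · rw [min_eq_left hsmall]
    exact le_add_of_nonneg_right (by positivity)
  have htangent : |x| - 5 / 2 ≤ Real.exp (|x| - 7 / 2) := by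
    linarith [Real.add_one_le_exp (|x| - 7 / 2)]
  have habs : 5 / 2 ≤ |x| := Real.le_sqrt' (by norm_num) |>.2 (by linarith) |>.trans_eq
    (Real.sqrt_sq_eq_abs x)
  calc x ^ 2 ≤ 25 / 2 + 2 * (|x| - 5 / 2) ^ 2 := by
        nlinarith [sq_nonneg (|x| - 5), sq_abs x]
    _ ≤ 25 / 2 + 2 * Real.exp (|x| - 7 / 2) ^ 2 := by gcongr
    _ = min (x ^ 2) (25 / 2) + 2 * Real.exp (-7) * Real.exp |2 * x| := by
        rw [min_eq_right hlarge, ← Real.exp_nat_mul, mul_assoc, ← Real.exp_add, abs_mul]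
        norm_num
        ring
    _ ≤ _ := by
        gcongr
        exact Real.exp_abs_le _

theorem exp_neg_three_le : Real.exp (-3) ≤ 1 / 20 := by
  rw [Real.exp_neg, one_div]
  refine inv_anti₀ (by norm_num) ?_
  calc (20 : ℝ) ≤ 2.718 ^ 3 := by norm_num
    _ ≤ Real.exp 1 ^ 3 := by
        gcongr
        linarith [Real.exp_one_gt_d9]
    _ = Real.exp 3 := by
        rw [Real.exp_one_pow]
        norm_num

-- The chord of `exp` over `[-3, 0]`, together with `exp (-3) ≤ 1 / 20`.
theorem exp_neg_mul_sq_le (x : ℝ) :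
    Real.exp (6 / 25 * -x ^ 2) ≤ 1 - 19 / 250 * min (x ^ 2) (25 / 2) := by
  rcases le_total (x ^ 2) (25 / 2) with hsmall | hlarge
  · have hchord := convexOn_exp.2 (Set.mem_univ (0 : ℝ)) (Set.mem_univ (-3 : ℝ))
      (sub_nonneg.2 (by linarith : 2 / 25 * x ^ 2 ≤ 1)) (by positivity : 0 ≤ 2 / 25 * x ^ 2)
      (by ring)
    simp only [smul_eq_mul, mul_zero, zero_add, Real.exp_zero, mul_one] at hchord
    rw [min_eq_left hsmall, show 6 / 25 * -x ^ 2 = 2 / 25 * x ^ 2 * -3 by ring]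
    nlinarith [sq_nonneg x, exp_neg_three_le]
  · rw [min_eq_right hlarge]
    have : Real.exp (6 / 25 * -x ^ 2) ≤ Real.exp (-3) := Real.exp_le_exp.2 (by linarith)
    linarith [exp_neg_three_le]

theorem integrable_min_sq [IsFiniteMeasure P] (hX : AEMeasurable X P) {b : ℝ} (hb : 0 ≤ b) :
    Integrable (fun ω => min (X ω ^ 2) b) P := by
  refine .of_bound ((hX.pow_const 2).min aemeasurable_const).aestronglyMeasurable b
    (.of_forall fun ω => ?_)
  rw [Real.norm_eq_abs, abs_of_nonneg (le_min (sq_nonneg _) hb)]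
  exact min_le_right _ _

theorem integrable_exp_mul_neg_sq [IsFiniteMeasure P] (hX : AEMeasurable X P) {t : ℝ}
    (ht : 0 ≤ t) : Integrable (fun ω => Real.exp (t * -X ω ^ 2)) P := by
  refine .of_bound (Real.measurable_exp.comp_aemeasurable
    ((hX.pow_const 2).neg.const_mul t)).aestronglyMeasurable 1 (.of_forall fun ω => ?_)
  rw [Real.norm_eq_abs, Real.abs_exp, Real.exp_le_one_iff]
  exact mul_nonpos_of_nonneg_of_nonpos ht (neg_nonpos.2 (sq_nonneg _))

theorem le_integral_min_sq [IsProbabilityMeasure P] (hX : HasSubgaussianMGF X 2 P)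
    (hvar : 1 ≤ ∫ ω, X ω ^ 2 ∂P) : 4 / 5 ≤ ∫ ω, min (X ω ^ 2) (25 / 2) ∂P := by
  have hmin := integrable_min_sq hX.aemeasurable (b := 25 / 2) (by norm_num)
  have hpos : Integrable (fun ω => Real.exp (2 * X ω)) P := hX.integrable_exp_mul 2
  have hneg : Integrable (fun ω => Real.exp (-(2 * X ω))) P := by
    simpa only [neg_mul] using hX.integrable_exp_mul (-2)
  have hsplit : 1 ≤ ∫ ω, min (X ω ^ 2) (25 / 2) ∂P + 2 * Real.exp (-7) *
      (∫ ω, Real.exp (2 * X ω) ∂P + ∫ ω, Real.exp (-(2 * X ω)) ∂P) := by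
    have hsum : Integrable (fun ω =>
        2 * Real.exp (-7) * (Real.exp (2 * X ω) + Real.exp (-(2 * X ω)))) P :=
      (hpos.add hneg).const_mul _
    rw [← integral_add hpos hneg, ← integral_const_mul, ← integral_add hmin hsum]
    exact hvar.trans <| integral_mono (hX.memLp 2).integrable_sq (hmin.add hsum) fun ω =>
      sq_le_min_add_exp (X ω)
  have hmgf_pos : ∫ ω, Real.exp (2 * X ω) ∂P ≤ Real.exp 4 := by
    refine (hX.mgf_le 2).trans_eq ?_
    norm_num
  have hmgf_neg : ∫ ω, Real.exp (-(2 * X ω)) ∂P ≤ Real.exp 4 := by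
    refine Eq.trans_le (by simp only [mgf, neg_mul]) ((hX.mgf_le (-2)).trans_eq ?_)
    norm_num
  have htail : 2 * Real.exp (-7) *
      (∫ ω, Real.exp (2 * X ω) ∂P + ∫ ω, Real.exp (-(2 * X ω)) ∂P) ≤ 1 / 5 :=
    calc _ ≤ 2 * Real.exp (-7) * (Real.exp 4 + Real.exp 4) := by gcongr
      _ = 4 * Real.exp (-3) := by
          rw [show (-3 : ℝ) = -7 + 4 by norm_num, Real.exp_add]
          ring
      _ ≤ 1 / 5 := by linarith [exp_neg_three_le]
  linarith

theorem mgf_neg_sq_le [IsProbabilityMeasure P] (hX : HasSubgaussianMGF X 2 P)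
    (hvar : 1 ≤ ∫ ω, X ω ^ 2 ∂P) :
    mgf (fun ω => -X ω ^ 2) P (6 / 25) ≤ Real.exp (-(3 / 50)) := by
  have hmin := integrable_min_sq hX.aemeasurable (b := 25 / 2) (by norm_num)
  calc mgf (fun ω => -X ω ^ 2) P (6 / 25)
      ≤ ∫ ω, (1 - 19 / 250 * min (X ω ^ 2) (25 / 2)) ∂P :=
        integral_mono (integrable_exp_mul_neg_sq hX.aemeasurable (by norm_num))
          ((integrable_const _).sub (hmin.const_mul _)) fun ω => exp_neg_mul_sq_le (X ω)
    _ = 1 - 19 / 250 * ∫ ω, min (X ω ^ 2) (25 / 2) ∂P := by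
        rw [integral_sub (integrable_const _) (hmin.const_mul _), integral_const_mul]
        simp
    _ ≤ -(3 / 50) + 1 := by linarith [le_integral_min_sq hX hvar]
    _ ≤ Real.exp (-(3 / 50)) := Real.add_one_le_exp _

theorem lintegral_exp_mul_sq_gaussianReal {a : ℝ} (ha : a < 1) :
    ∫⁻ g, ENNReal.ofReal (Real.exp (a * g ^ 2 / 2)) ∂gaussianReal 0 1 =
      ENNReal.ofReal (1 / √(1 - a)) := by
  have hb : 0 < (1 - a) / 2 := by linarith
  have hdensity (g : ℝ) : gaussianPDF 0 1 g * ENNReal.ofReal (Real.exp (a * g ^ 2 / 2)) =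
      ENNReal.ofReal ((√(2 * Real.pi))⁻¹ * Real.exp (-((1 - a) / 2) * g ^ 2)) := by
    rw [gaussianPDF, ← ENNReal.ofReal_mul (gaussianPDFReal_nonneg _ _ _)]
    simp only [gaussianPDFReal, NNReal.coe_one, mul_one, sub_zero]
    rw [mul_assoc, ← Real.exp_add]
    ring_nf
  rw [gaussianReal_of_var_ne_zero 0 one_ne_zero,
    lintegral_withDensity_eq_lintegral_mul _ (measurable_gaussianPDF 0 1) (by fun_prop)]
  simp only [Pi.mul_apply, hdensity]
  rw [← ofReal_integral_eq_lintegral_ofReal ((integrable_exp_neg_mul_sq hb).const_mul _)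
    (.of_forall fun g => by positivity), integral_const_mul, integral_gaussian]
  congr 1
  have hpi : Real.pi / ((1 - a) / 2) = 2 * Real.pi / (1 - a) := by field_simp
  rw [hpi, Real.sqrt_div' _ (by linarith), ← mul_div_assoc,
    inv_mul_cancel₀ (Real.sqrt_pos.2 Real.two_pi_pos).ne']

-- `exp (t x²) = E exp (√(2t) x g)` for a standard Gaussian `g`; then integrate over `X` first.
theorem lintegral_exp_mul_sq_le [IsProbabilityMeasure P] {c : NNReal}
    (hX : HasSubgaussianMGF X c P) {t : ℝ} (ht : 0 ≤ t) (hct : 2 * c * t < 1) :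
    ∫⁻ ω, ENNReal.ofReal (Real.exp (t * X ω ^ 2)) ∂P ≤
      ENNReal.ofReal (1 / √(1 - 2 * c * t)) := by
  have hsq : √(2 * t) ^ 2 = 2 * t := Real.sq_sqrt (by positivity)
  have hgauss (x : ℝ) : ENNReal.ofReal (Real.exp (t * x ^ 2)) =
      ∫⁻ g, ENNReal.ofReal (Real.exp (√(2 * t) * x * g)) ∂gaussianReal 0 1 := by
    rw [← ofReal_integral_eq_lintegral_ofReal (integrable_exp_mul_gaussianReal _)
      (.of_forall fun g => (Real.exp_pos _).le)]
    have hmgf := congrFun (mgf_fun_id_gaussianReal (μ := 0) (v := 1)) (√(2 * t) * x)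
    unfold mgf at hmgf
    rw [hmgf, mul_pow, hsq]
    simp only [zero_mul, NNReal.coe_one, one_mul, zero_add]
    ring_nf
  have hmeas : AEMeasurable (Function.uncurry fun ω g =>
      ENNReal.ofReal (Real.exp (√(2 * t) * X ω * g))) (P.prod (gaussianReal 0 1)) :=
    ENNReal.measurable_ofReal.comp_aemeasurable <| Real.measurable_exp.comp_aemeasurable <|
      (hX.aemeasurable.comp_fst.const_mul _).mul measurable_snd.aemeasurable
  simp_rw [hgauss]
  rw [lintegral_lintegral_swap hmeas, ← lintegral_exp_mul_sq_gaussianReal hct]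
  refine lintegral_mono fun g => ?_
  simp_rw [mul_right_comm _ (X _) g]
  rw [← ofReal_integral_eq_lintegral_ofReal (hX.integrable_exp_mul _)
    (.of_forall fun ω => (Real.exp_pos _).le)]
  refine ENNReal.ofReal_le_ofReal ((hX.mgf_le _).trans_eq ?_)
  rw [mul_pow, hsq]
  ring_nf

theorem integrable_exp_mul_sq [IsProbabilityMeasure P] {c : NNReal}
    (hX : HasSubgaussianMGF X c P) {t : ℝ} (ht : 0 ≤ t) (hct : 2 * c * t < 1) :
    Integrable (fun ω => Real.exp (t * X ω ^ 2)) P := by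
  refine ⟨(Real.measurable_exp.comp_aemeasurable
    ((hX.aemeasurable.pow_const 2).const_mul t)).aestronglyMeasurable, ?_⟩
  rw [hasFiniteIntegral_iff_ofReal (.of_forall fun ω => (Real.exp_pos _).le)]
  exact (lintegral_exp_mul_sq_le hX ht hct).trans_lt ENNReal.ofReal_lt_top

theorem mgf_sq_le [IsProbabilityMeasure P] {c : NNReal} (hX : HasSubgaussianMGF X c P) {t : ℝ}
    (ht : 0 ≤ t) (hct : 2 * c * t < 1) :
    mgf (fun ω => X ω ^ 2) P t ≤ 1 / √(1 - 2 * c * t) := by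
  rw [mgf, integral_eq_lintegral_of_nonneg_ae (.of_forall fun ω => (Real.exp_pos _).le)
    (integrable_exp_mul_sq hX ht hct).aestronglyMeasurable]
  exact ENNReal.toReal_le_of_le_ofReal (by positivity) (lintegral_exp_mul_sq_le hX ht hct)

variable {ι : Type*} [Fintype ι] {Y : ι → Ω → ℝ}

theorem measure_ge_sum_le_exp (hind : iIndepFun Y P) (hY : ∀ i, Measurable (Y i)) {t b : ℝ}
    (ht : 0 ≤ t) (hexp : ∀ i, Integrable (fun ω => Real.exp (t * Y i ω)) P)
    (hmgf : ∀ i, mgf (Y i) P t ≤ Real.exp b) (ε : ℝ) :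
    P.real {ω | ε ≤ ∑ i, Y i ω} ≤ Real.exp (-t * ε + Fintype.card ι * b) := by
  have := hind.isProbabilityMeasure
  have hchernoff := measure_ge_le_exp_mul_mgf ε ht
    (hind.integrable_exp_mul_sum hY (s := Finset.univ) fun i _ => hexp i)
  simp only [Finset.sum_apply] at hchernoff
  refine hchernoff.trans ?_
  rw [hind.mgf_sum hY, Real.exp_add]
  gcongr
  calc ∏ i, mgf (Y i) P t ≤ ∏ _i : ι, Real.exp b :=
        Finset.prod_le_prod (fun i _ => mgf_nonneg) fun i _ => hmgf i
    _ = Real.exp (Fintype.card ι * b) := by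
        rw [Finset.prod_const, Finset.card_univ, Real.exp_nat_mul]

theorem measure_sum_sq_le_le (hind : iIndepFun Y P) (hm : ∀ i, Measurable (Y i))
    (hY : ∀ i, HasSubgaussianMGF (Y i) 2 P) (hvar : ∀ i, 1 ≤ ∫ ω, Y i ω ^ 2 ∂P) :
    P.real {ω | ∑ i, Y i ω ^ 2 ≤ Fintype.card ι / 50} ≤
      Real.exp (-(1 / 20) * Fintype.card ι) := by
  have := hind.isProbabilityMeasure
  have hchernoff := measure_ge_sum_le_exp
    (hind.comp (fun _ y => -y ^ 2) fun _ => by fun_prop) (fun i => by fun_prop)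
    (t := 6 / 25) (by norm_num)
    (fun i => integrable_exp_mul_neg_sq (hm i).aemeasurable (by norm_num))
    (fun i => mgf_neg_sq_le (hY i) (hvar i)) (-(Fintype.card ι / 50))
  simp only [Function.comp_apply, Finset.sum_neg_distrib, neg_le_neg_iff] at hchernoff
  refine hchernoff.trans (Real.exp_le_exp.2 ?_)
  linarith [(Fintype.card ι).cast_nonneg (α := ℝ)]

theorem measure_ge_sum_sq_le (hind : iIndepFun Y P) (hm : ∀ i, Measurable (Y i))
    (hY : ∀ i, HasSubgaussianMGF (Y i) 2 P) :
    P.real {ω | 4 * (Fintype.card ι : ℝ) ≤ ∑ i, Y i ω ^ 2} ≤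
      Real.exp (-(1 / 10) * Fintype.card ι) := by
  have := hind.isProbabilityMeasure
  have hct : 2 * ((2 : NNReal) : ℝ) * (1 / 8) < 1 := by norm_num
  have hexp : 1 / √(1 - 2 * ((2 : NNReal) : ℝ) * (1 / 8)) ≤ Real.exp (2 / 5) :=
    calc 1 / √(1 - 2 * ((2 : NNReal) : ℝ) * (1 / 8)) = √2 := by
          rw [one_div, ← Real.sqrt_inv]
          norm_num
      _ ≤ 1 + 2 / 5 + (2 / 5) ^ 2 / 2 := Real.sqrt_le_iff.2 (by norm_num)
      _ ≤ Real.exp (2 / 5) := Real.quadratic_le_exp_of_nonneg (by norm_num)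
  have hchernoff := measure_ge_sum_le_exp
    (hind.comp (fun _ y => y ^ 2) fun _ => by fun_prop) (fun i => by fun_prop)
    (t := 1 / 8) (by norm_num) (fun i => integrable_exp_mul_sq (hY i) (by norm_num) hct)
    (fun i => (mgf_sq_le (hY i) (by norm_num) hct).trans hexp) (4 * Fintype.card ι)
  refine hchernoff.trans (Real.exp_le_exp.2 ?_)
  linarith

end SubgaussianSquares

section Sparsification

theorem sum_mul_quadratic_add {E α : Type*} [AddCommGroup E] [Module ℝ E] [Fintype α]
    (B : E →ₗ[ℝ] E →ₗ[ℝ] ℝ) (e : α → E) {w : α → ℝ} (hw : ∑ i, w i = 1) (y : E) :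
    ∑ i, w i * B (y + e i) (y + e i) =
      B (y + ∑ i, w i • e i) (y + ∑ i, w i • e i) +
        (∑ i, w i * B (e i) (e i) - B (∑ i, w i • e i) (∑ i, w i • e i)) := by
  have hexpand : ∑ i, w i * B (y + e i) (y + e i) = (∑ i, w i) * B y y + ∑ i, w i * B y (e i) +
      ∑ i, w i * B (e i) y + ∑ i, w i * B (e i) (e i) := by
    simp only [Finset.sum_mul, ← Finset.sum_add_distrib, map_add, LinearMap.add_apply]
    exact Finset.sum_congr rfl fun i _ => by ring
  have hright : B y (∑ i, w i • e i) = ∑ i, w i * B y (e i) := by simp [map_sum]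
  have hleft : B (∑ i, w i • e i) y = ∑ i, w i * B (e i) y := by
    simp [map_sum, LinearMap.sum_apply]
  rw [hexpand, hw, ← hright, ← hleft]
  simp only [map_add, LinearMap.add_apply]
  ring

-- The empirical method of Maurey: were the `N` vectors drawn independently with weights `w`, the
-- left-hand side would be the expectation of the quadratic form at `y` plus their sum.
theorem quadratic_nonneg_of_multisets {E α : Type*} [AddCommGroup E] [Module ℝ E] [Fintype α]
    (B : E →ₗ[ℝ] E →ₗ[ℝ] ℝ) (e : α → E) {w : α → ℝ} (hw_nonneg : ∀ i, 0 ≤ w i)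
    (hw : ∑ i, w i = 1) {N : ℕ} {y : E}
    (h : ∀ σ : Sym α N, 0 ≤ B (y + (σ.1.map e).sum) (y + (σ.1.map e).sum)) :
    0 ≤ B (y + (N : ℝ) • ∑ i, w i • e i) (y + (N : ℝ) • ∑ i, w i • e i) +
      N * (∑ i, w i * B (e i) (e i) - B (∑ i, w i • e i) (∑ i, w i • e i)) := by
  have haverage := sum_mul_quadratic_add B e hw
  set v := ∑ i, w i • e i
  set V := ∑ i, w i * B (e i) (e i) - B v v
  induction N generalizing y with
  | zero => simpa using h Sym.nil
  | succ N ih =>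
    have hfirst (i : α) :
        0 ≤ B (y + (N : ℝ) • v + e i) (y + (N : ℝ) • v + e i) + N * V := by
      rw [add_right_comm]
      refine ih fun σ => ?_
      have hcons : ((i ::ₛ σ).1.map e).sum = e i + (σ.1.map e).sum := by
        rw [Sym.cons, Multiset.map_cons, Multiset.sum_cons]
      simpa only [hcons, add_assoc] using h (i ::ₛ σ)
    have hsum := Finset.sum_nonneg fun i (_ : i ∈ Finset.univ) =>
      mul_nonneg (hw_nonneg i) (hfirst i)
    simp only [mul_add, Finset.sum_add_distrib] at hsum
    rw [← Finset.sum_mul, hw, one_mul, haverage] at hsum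
    have hsucc : y + ((N + 1 : ℕ) : ℝ) • v = y + (N : ℝ) • v + v := by
      rw [Nat.cast_succ, add_smul, one_smul, add_assoc]
    rw [hsucc, Nat.cast_succ]
    linarith

variable {ι κ : Type*} [Fintype ι] [DecidableEq ι] [Fintype κ]

/-- The signed unit vectors `± e_j`, with sign `+` for `true`: the vertices of the `ℓ_1`-ball. -/
noncomputable def signedUnit (a : ι × Bool) : EuclideanSpace ℝ ι :=
  EuclideanSpace.single a.1 (if a.2 then 1 else -1)

theorem sum_inner_signedUnit_sq (φ : κ → EuclideanSpace ℝ ι) (a : ι × Bool) :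
    ∑ i, inner ℝ (φ i) (signedUnit a) ^ 2 = ∑ i, φ i a.1 ^ 2 := by
  refine Finset.sum_congr rfl fun i _ => ?_
  rw [signedUnit, EuclideanSpace.inner_single_right]
  split_ifs <;> simp

theorem exists_weights_signedUnit {v : EuclideanSpace ℝ ι} (hv : 0 < ∑ j, |v j|) :
    ∃ w : ι × Bool → ℝ, (∀ a, 0 ≤ w a) ∧ ∑ a, w a = 1 ∧
      (∑ j, |v j|) • ∑ a, w a • signedUnit a = v := by
  set b := ∑ j, |v j|
  refine ⟨fun a => b⁻¹ * if a.2 then max (v a.1) 0 else max (-v a.1) 0, fun a => ?_, ?_, ?_⟩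
  · have : 0 ≤ if a.2 then max (v a.1) 0 else max (-v a.1) 0 := by split_ifs <;> simp
    positivity
  · simp only [← Finset.mul_sum, Fintype.sum_prod_type, Fintype.sum_bool, if_true,
      Bool.false_eq_true, if_false, max_zero_add_max_neg_zero_eq_abs_self]
    exact inv_mul_cancel₀ hv.ne'
  · simp only [mul_smul, ← Finset.smul_sum, smul_inv_smul₀ hv.ne']
    ext i
    simp only [Fintype.sum_prod_type, Fintype.sum_bool, if_true, Bool.false_eq_true, if_false,
      signedUnit, WithLp.ofLp_sum, WithLp.ofLp_add, WithLp.ofLp_smul, Finset.sum_apply,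
      Pi.add_apply, Pi.smul_apply, PiLp.single_apply, smul_eq_mul, mul_ite, mul_one,
      mul_neg, mul_zero, Finset.sum_add_distrib, Finset.sum_ite_eq, Finset.mem_univ]
    exact max_zero_sub_max_neg_zero_eq_self _

theorem quadratic_ge_of_multisets
    (B : EuclideanSpace ℝ ι →ₗ[ℝ] EuclideanSpace ℝ ι →ₗ[ℝ] ℝ) {N : ℕ} (hN : N ≠ 0) {C : ℝ}
    (hB : ∀ σ : Sym (ι × Bool) N, 0 ≤ B (σ.1.map signedUnit).sum (σ.1.map signedUnit).sum)
    (hC : ∀ a, B (signedUnit a) (signedUnit a) ≤ C) (v : EuclideanSpace ℝ ι) :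
    0 ≤ ((N : ℝ) - 1) * B v v + (∑ j, |v j|) ^ 2 * C := by
  rcases (Finset.sum_nonneg fun j (_ : j ∈ Finset.univ) => abs_nonneg (v j)).eq_or_lt
    with hv | hv
  · have hv_zero : v = 0 := by
      ext j
      exact abs_eq_zero.1 <| (Finset.sum_eq_zero_iff_of_nonneg fun j _ => abs_nonneg (v j)).1
        hv.symm j (Finset.mem_univ j)
    simp [hv_zero]
  obtain ⟨w, hw_nonneg, hw, hwv⟩ := exists_weights_signedUnit hv
  have hmaurey := quadratic_nonneg_of_multisets B signedUnit hw_nonneg hw (y := 0)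
    (by simpa only [zero_add] using hB)
  set b := ∑ j, |v j|
  set u := ∑ a, w a • signedUnit a
  have hvertices : ∑ a, w a * B (signedUnit a) (signedUnit a) ≤ C :=
    calc ∑ a, w a * B (signedUnit a) (signedUnit a) ≤ ∑ a, w a * C := by
          gcongr with a
          exacts [hw_nonneg a, hC a]
      _ = C := by rw [← Finset.sum_mul, hw, one_mul]
  simp only [zero_add, map_smul, LinearMap.smul_apply, smul_eq_mul] at hmaurey
  have hN_pos : (0 : ℝ) < N := Nat.cast_pos.2 (Nat.pos_of_ne_zero hN)
  have hu : 0 ≤ ((N : ℝ) - 1) * B u u + C := by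
    refine nonneg_of_mul_nonneg_right ?_ hN_pos
    linarith [mul_le_mul_of_nonneg_left hvertices hN_pos.le]
  have hBv : B v v = b ^ 2 * B u u := by
    rw [← hwv]
    simp only [map_smul, LinearMap.smul_apply, smul_eq_mul]
    ring
  rw [hBv]
  linarith [mul_nonneg (sq_nonneg b) hu]

theorem sum_inner_sq_ge_of_multisets {N : ℕ} (hN : N ≠ 0) {c C : ℝ} (hc : 0 ≤ c)
    (φ : κ → EuclideanSpace ℝ ι)
    (hsum : ∀ σ : Sym (ι × Bool) N, c * ‖(σ.1.map signedUnit).sum‖ ^ 2 ≤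
      ∑ i, inner ℝ (φ i) (σ.1.map signedUnit).sum ^ 2)
    (hcoord : ∀ j, ∑ i, φ i j ^ 2 ≤ C) (v : EuclideanSpace ℝ ι) :
    ((N : ℝ) - 1) * (c * ‖v‖ ^ 2) ≤
      ((N : ℝ) - 1) * ∑ i, inner ℝ (φ i) v ^ 2 + (∑ j, |v j|) ^ 2 * C := by
  let B : EuclideanSpace ℝ ι →ₗ[ℝ] EuclideanSpace ℝ ι →ₗ[ℝ] ℝ :=
    ∑ i, (innerₗ _ (φ i)).smulRight (innerₗ _ (φ i)) - c • innerₗ _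
  have hB (u : EuclideanSpace ℝ ι) : B u u = ∑ i, inner ℝ (φ i) u ^ 2 - c * ‖u‖ ^ 2 := by
    simp [B, LinearMap.sum_apply, sq]
  have hquad := quadratic_ge_of_multisets B hN (C := C)
    (fun σ => by rw [hB]; exact sub_nonneg.2 (hsum σ))
    (fun a => by
      rw [hB, sum_inner_signedUnit_sq]
      exact (sub_le_self _ (by positivity)).trans (hcoord a.1)) v
  rw [hB] at hquad
  linarith

theorem card_sym_signs_le {s N : ℕ} (hs : 0 < s) (hsι : s ≤ Fintype.card ι) (hsN : s ≤ N) :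
    (Fintype.card (Sym (ι × Bool) N) : ℝ) ≤
      Real.exp (N * (Real.log 3 + Real.log (Real.exp 1 * Fintype.card ι / s))) := by
  set n := Fintype.card ι
  have : (0 : ℝ) < s := Nat.cast_pos.2 hs
  have hn_pos : (0 : ℝ) < n := Nat.cast_pos.2 (hs.trans_le hsι)
  have hsι' : (s : ℝ) ≤ n := Nat.cast_le.2 hsι
  have hsN' : (s : ℝ) ≤ N := Nat.cast_le.2 hsN
  have hcard : ((Fintype.card (ι × Bool) + N - 1 : ℕ) : ℝ) ≤ 3 * n / s * N :=
    calc ((Fintype.card (ι × Bool) + N - 1 : ℕ) : ℝ) ≤ (2 * n + N : ℕ) := by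
          rw [Nat.cast_le, Fintype.card_prod, Fintype.card_bool]
          omega
      _ = (2 * n * s + N * s) / s := by
          push_cast
          field_simp
      _ ≤ (2 * n * N + N * n) / s := by gcongr
      _ = 3 * n / s * N := by ring
  rw [Sym.card_sym_eq_multichoose, Nat.multichoose_eq]
  calc ((Fintype.card (ι × Bool) + N - 1).choose N : ℝ)
      ≤ ((Fintype.card (ι × Bool) + N - 1 : ℕ) : ℝ) ^ N / N.factorial := Nat.choose_le_pow_div _ _
    _ ≤ (3 * n / s * N : ℝ) ^ N / N.factorial := by gcongr
    _ = (3 * n / s : ℝ) ^ N * ((N : ℝ) ^ N / N.factorial) := by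
        rw [mul_pow]
        ring
    _ ≤ (3 * n / s : ℝ) ^ N * Real.exp N := by
        gcongr
        exact Real.pow_div_factorial_le_exp (x := N) N.cast_nonneg N
    _ = Real.exp (N * (Real.log 3 + Real.log (Real.exp 1 * n / s))) := by
        rw [← Real.log_mul (by norm_num) (by positivity), Real.exp_nat_mul,
          Real.exp_log (by positivity), ← Real.exp_one_pow, ← mul_pow]
        congr 1
        ring

end Sparsification

section RandomRows

variable {Ω : Type*} [MeasurableSpace Ω] {P : Measure Ω} {n : ℕ}

theorem IsOneSubgaussian.hasSubgaussianMGF {X : Ω → EuclideanSpace ℝ (Fin n)}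
    (hX : IsOneSubgaussian P X) {v : EuclideanSpace ℝ (Fin n)} (hv : ‖v‖ ≤ 1) :
    HasSubgaussianMGF (fun ω => inner ℝ (X ω) v) 2 P where
  integrable_exp_mul t := (hX v (pow_le_one₀ (norm_nonneg v) hv) t).1
  mgf_le t := by
    refine (hX v (pow_le_one₀ (norm_nonneg v) hv) t).2.trans_eq ?_
    rw [NNReal.coe_ofNat, mul_div_cancel_left₀ _ two_ne_zero]

theorem IsOneSubgaussian.hasSubgaussianMGF_apply {X : Ω → EuclideanSpace ℝ (Fin n)}
    (hX : IsOneSubgaussian P X) (j : Fin n) : HasSubgaussianMGF (fun ω => X ω j) 2 P := by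
  simpa [EuclideanSpace.inner_single_right] using
    hX.hasSubgaussianMGF (v := EuclideanSpace.single j 1) (by simp)

theorem measureReal_exists_le {α : Type*} [Fintype α] {p : α → Ω → Prop} {ε : ℝ}
    (h : ∀ a, P.real {ω | p a ω} ≤ ε) : P.real {ω | ∃ a, p a ω} ≤ Fintype.card α * ε :=
  calc P.real {ω | ∃ a, p a ω} = P.real (⋃ a, {ω | p a ω}) := by rw [Set.ofPred_exists]
    _ ≤ ∑ a, P.real {ω | p a ω} := measureReal_iUnion_fintype_le _
    _ ≤ ∑ _a : α, ε := Finset.sum_le_sum fun a _ => h a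
    _ = Fintype.card α * ε := by rw [Finset.sum_const, Finset.card_univ, nsmul_eq_mul]

theorem exists_sample_size {R Λ k : ℝ} (hR : 1 ≤ R) (hΛ : 0 ≤ Λ)
    (hk : 384 ^ 2 * R * (2 + √Λ) ^ 2 ≤ k) :
    ∃ N : ℕ, N * (100 * (2 + Λ)) ≤ k ∧ 1472 * R ≤ (N : ℝ) - 1 := by
  have hsq : 2 + Λ ≤ (2 + √Λ) ^ 2 := by
    rw [add_sq, Real.sq_sqrt hΛ]
    linarith [Real.sqrt_nonneg Λ]
  have hk_div : 1474 * R ≤ k / (100 * (2 + Λ)) := by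
    rw [le_div_iff₀ (by positivity)]
    calc 1474 * R * (100 * (2 + Λ)) = 147400 * (R * (2 + Λ)) := by ring
      _ ≤ 384 ^ 2 * (R * (2 + √Λ) ^ 2) := by gcongr; norm_num
      _ ≤ k := by rwa [← mul_assoc]
  refine ⟨⌊k / (100 * (2 + Λ))⌋₊, ?_, ?_⟩
  · rw [← le_div_iff₀ (by positivity)]
    exact Nat.floor_le (le_trans (by positivity) hk_div)
  · linarith [Nat.lt_floor_add_one (k / (100 * (2 + Λ)))]

variable {κ : Type*} [Fintype κ] {φ : κ → Ω → EuclideanSpace ℝ (Fin n)} {s N : ℕ}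

theorem measure_sum_inner_sq_lt_le (hind : iIndepFun φ P) (hm : ∀ i, Measurable (φ i))
    (hsg : ∀ i, IsOneSubgaussian P (φ i)) (hiso : ∀ i, IsSubIsotropic P (φ i))
    (u : EuclideanSpace ℝ (Fin n)) :
    P.real {ω | ∑ i, inner ℝ (φ i ω) u ^ 2 < Fintype.card κ / 50 * ‖u‖ ^ 2} ≤
      Real.exp (-(1 / 20) * Fintype.card κ) := by
  have := hind.isProbabilityMeasure
  rcases eq_or_ne u 0 with rfl | hu
  · simp [Real.exp_nonneg]
  have hu_pos : 0 < ‖u‖ := norm_pos_iff.2 hu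
  set v := ‖u‖⁻¹ • u with hv
  have hv_norm : ‖v‖ = 1 := norm_smul_inv_norm hu
  have huv (x : EuclideanSpace ℝ (Fin n)) : inner ℝ x u = ‖u‖ * inner ℝ x v := by
    rw [hv, inner_smul_right, mul_inv_cancel_left₀ hu_pos.ne']
  have hunit := measure_sum_sq_le_le (Y := fun i ω => inner ℝ (φ i ω) v)
    (hind.comp (fun _ x => inner ℝ x v) fun _ => by fun_prop) (fun i => by fun_prop)
    (fun i => (hsg i).hasSubgaussianMGF hv_norm.le) (fun i => by simpa [hv_norm] using hiso i v)
  refine (measureReal_mono fun ω hω => ?_).trans hunit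
  simp only [Set.mem_ofPred_eq, huv, mul_pow, ← Finset.mul_sum] at hω ⊢
  rw [mul_comm] at hω
  exact (lt_of_mul_lt_mul_right hω (by positivity)).le

theorem measure_ge_sum_coord_sq_le (hind : iIndepFun φ P) (hm : ∀ i, Measurable (φ i))
    (hsg : ∀ i, IsOneSubgaussian P (φ i)) (j : Fin n) :
    P.real {ω | 4 * (Fintype.card κ : ℝ) ≤ ∑ i, φ i ω j ^ 2} ≤
      Real.exp (-(1 / 10) * Fintype.card κ) :=
  measure_ge_sum_sq_le (hind.comp (fun _ x => x j) fun _ => by fun_prop)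
    (fun i => by fun_prop) fun i => (hsg i).hasSubgaussianMGF_apply j

theorem measure_ge_abs_sum_coord_le (hind : iIndepFun φ P) (hsg : ∀ i, IsOneSubgaussian P (φ i))
    (j : Fin n) {ε : ℝ} (hε : 0 ≤ ε) :
    P.real {ω | ε ≤ |∑ i, φ i ω j|} ≤ 2 * Real.exp (-(ε ^ 2 / (4 * Fintype.card κ))) := by
  have hsum : HasSubgaussianMGF (fun ω => ∑ i, φ i ω j) (∑ _i : κ, 2) P :=
    .sum_of_iIndepFun (hind.comp (fun _ x => x j) fun _ => by fun_prop)
      fun i _ => (hsg i).hasSubgaussianMGF_apply j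
  have hexponent : -ε ^ 2 / (2 * ((∑ _i : κ, 2 : NNReal) : ℝ)) =
      -(ε ^ 2 / (4 * Fintype.card κ)) := by
    rw [neg_div, Finset.sum_const, Finset.card_univ, nsmul_eq_mul]
    push_cast
    ring_nf
  have hupper := hexponent ▸ hsum.measure_ge_le hε
  have hlower := hexponent ▸ hsum.neg.measure_ge_le hε
  calc P.real {ω | ε ≤ |∑ i, φ i ω j|}
      = P.real ({ω | ε ≤ ∑ i, φ i ω j} ∪ {ω | ε ≤ -∑ i, φ i ω j}) := by
        simp only [le_abs, Set.ofPred_or]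
    _ ≤ _ := measureReal_union_le _ _
    _ ≤ 2 * Real.exp (-(ε ^ 2 / (4 * Fintype.card κ))) := by
        rw [two_mul]
        exact add_le_add hupper hlower

theorem measure_exists_multiset_sum_inner_sq_lt_le (hind : iIndepFun φ P)
    (hm : ∀ i, Measurable (φ i)) (hsg : ∀ i, IsOneSubgaussian P (φ i))
    (hiso : ∀ i, IsSubIsotropic P (φ i)) (hs : 0 < s) (hsn : s ≤ n) (hsN : s ≤ N)
    (hN : N * (100 * (2 + Real.log (Real.exp 1 * n / s))) ≤ Fintype.card κ) :
    P.real {ω | ∃ σ : Sym (Fin n × Bool) N, ∑ i, inner ℝ (φ i ω) (σ.1.map signedUnit).sum ^ 2 <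
      Fintype.card κ / 50 * ‖(σ.1.map signedUnit).sum‖ ^ 2} ≤
        Real.exp (-(1 / 25) * Fintype.card κ) := by
  have hcard := card_sym_signs_le hs (hsn.trans_eq (Fintype.card_fin n).symm) hsN
  rw [Fintype.card_fin] at hcard
  have hlog_three : Real.log 3 ≤ 2 := by
    linarith [Real.log_le_sub_one_of_pos (zero_lt_three (α := ℝ))]
  refine (measureReal_exists_le fun σ => measure_sum_inner_sq_lt_le hind hm hsg hiso _).trans ?_
  refine (mul_le_mul_of_nonneg_right hcard (Real.exp_nonneg _)).trans ?_
  rw [← Real.exp_add, Real.exp_le_exp]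
  linarith [mul_le_mul_of_nonneg_left hlog_three N.cast_nonneg]

theorem measure_exists_ge_sum_coord_sq_le (hind : iIndepFun φ P) (hm : ∀ i, Measurable (φ i))
    (hsg : ∀ i, IsOneSubgaussian P (φ i)) (hn : (n : ℝ) ≤ Real.exp (3 / 50 * Fintype.card κ)) :
    P.real {ω | ∃ j, 4 * (Fintype.card κ : ℝ) ≤ ∑ i, φ i ω j ^ 2} ≤
      Real.exp (-(1 / 25) * Fintype.card κ) := by
  refine (measureReal_exists_le fun j => measure_ge_sum_coord_sq_le hind hm hsg j).trans ?_
  rw [Fintype.card_fin]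
  refine (mul_le_mul_of_nonneg_right hn (Real.exp_nonneg _)).trans_eq ?_
  rw [← Real.exp_add]
  congr 1
  ring

theorem sum_inner_sq_ge_of_sum_abs_le {R k : ℝ} (hk : 0 ≤ k) (hR : 1 ≤ R)
    (hN : 1472 * R ≤ (N : ℝ) - 1) {ψ : κ → EuclideanSpace ℝ (Fin n)}
    (hsum : ∀ σ : Sym (Fin n × Bool) N, k / 50 * ‖(σ.1.map signedUnit).sum‖ ^ 2 ≤
      ∑ i, inner ℝ (ψ i) (σ.1.map signedUnit).sum ^ 2)
    (hcoord : ∀ j, ∑ i, ψ i j ^ 2 ≤ 4 * k) {v : EuclideanSpace ℝ (Fin n)}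
    (hv : (∑ j, |v j|) ^ 2 ≤ 4 * R * ‖v‖ ^ 2) :
    k / 128 * ‖v‖ ^ 2 ≤ ∑ i, inner ℝ (ψ i) v ^ 2 := by
  have hN_pos : 0 < (N : ℝ) - 1 := by linarith
  have hN_ne : N ≠ 0 := by
    rintro rfl
    norm_num at hN_pos
  have hsparse := sum_inner_sq_ge_of_multisets hN_ne (by positivity) ψ hsum hcoord v
  have herror : (∑ j, |v j|) ^ 2 * (4 * k) ≤ ((N : ℝ) - 1) * (16 / 1472 * k * ‖v‖ ^ 2) :=
    calc (∑ j, |v j|) ^ 2 * (4 * k) ≤ 4 * R * ‖v‖ ^ 2 * (4 * k) := by gcongr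
      _ = 1472 * R * (16 / 1472 * k * ‖v‖ ^ 2) := by ring
      _ ≤ ((N : ℝ) - 1) * (16 / 1472 * k * ‖v‖ ^ 2) := by gcongr
  refine le_of_mul_le_mul_left ?_ hN_pos
  have : 0 ≤ ((N : ℝ) - 1) * (k * ‖v‖ ^ 2) := by positivity
  linarith

theorem log_exp_one_mul_div_nonneg (hs : 0 < s) (hsn : s ≤ n) :
    0 ≤ Real.log (Real.exp 1 * n / s) := by
  refine Real.log_nonneg ((one_le_div (Nat.cast_pos.2 hs)).2 ?_)
  exact (Nat.cast_le.2 hsn).trans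
    (le_mul_of_one_le_left n.cast_nonneg (Real.one_le_exp zero_le_one))

theorem natCast_le_exp_add_log (hs : 0 < s) :
    (n : ℝ) ≤ Real.exp (s + Real.log (Real.exp 1 * n / s)) := by
  rcases n.eq_zero_or_pos with rfl | hn
  · simpa using Real.exp_nonneg _
  have : (0 : ℝ) < s := Nat.cast_pos.2 hs
  rw [Real.exp_add, Real.exp_log (by positivity)]
  calc (n : ℝ) = s * (1 * n / s) := by field_simp
    _ ≤ Real.exp s * (Real.exp 1 * n / s) := by
        gcongr
        · linarith [Real.add_one_le_exp (s : ℝ)]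
        · exact Real.one_le_exp zero_le_one

theorem measure_exists_sum_inner_sq_lt_le (hind : iIndepFun φ P) (hm : ∀ i, Measurable (φ i))
    (hsg : ∀ i, IsOneSubgaussian P (φ i)) (hiso : ∀ i, IsSubIsotropic P (φ i)) (hs : 0 < s)
    (hsn : s ≤ n) {R : ℝ} (hR : s ≤ R)
    (hk : 384 ^ 2 * R * (2 + √(Real.log (Real.exp 1 * n / s))) ^ 2 ≤ Fintype.card κ) :
    P.real {ω | ∃ v : EuclideanSpace ℝ (Fin n), (∑ j, |v j|) ^ 2 ≤ 4 * R * ‖v‖ ^ 2 ∧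
      ∑ i, inner ℝ (φ i ω) v ^ 2 < Fintype.card κ / 128 * ‖v‖ ^ 2} ≤
        Real.exp (-(Fintype.card κ : ℝ) / 32) := by
  have := hind.isProbabilityMeasure
  have hR_one : 1 ≤ R := le_trans (Nat.one_le_cast.2 hs) hR
  have hΛ := log_exp_one_mul_div_nonneg hs hsn
  have hn := natCast_le_exp_add_log (n := n) hs
  set Λ := Real.log (Real.exp 1 * n / s)
  obtain ⟨N, hNk, hRN⟩ := exists_sample_size hR_one hΛ hk
  have hsN : s ≤ N := by
    have : (s : ℝ) ≤ N := by linarith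
    exact_mod_cast this
  have hNΛ : 2 + Λ ≤ N * (2 + Λ) := le_mul_of_one_le_left (by linarith) (by linarith)
  have hmultisets := measure_exists_multiset_sum_inner_sq_lt_le hind hm hsg hiso hs hsn hsN hNk
  have hcoords := measure_exists_ge_sum_coord_sq_le hind hm hsg
    (hn.trans (Real.exp_le_exp.2 (by nlinarith)))
  set k : ℝ := (Fintype.card κ : ℝ)
  refine (measureReal_mono fun ω hω => ?_).trans <|
    (measureReal_union_le _ _).trans <| (add_le_add hmultisets hcoords).trans ?_
  · obtain ⟨v, hv, hlt⟩ := hω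
    by_contra hgood
    simp only [Set.mem_union, Set.mem_ofPred_eq, not_or, not_exists, not_lt, not_le] at hgood
    exact hlt.not_ge <| sum_inner_sq_ge_of_sum_abs_le (Nat.cast_nonneg _) hR_one hRN hgood.1
      (fun j => (hgood.2 j).le) hv
  · have htwo : 2 ≤ Real.exp (7 / 800 * k) := by
      linarith [Real.add_one_le_exp (7 / 800 * k)]
    calc Real.exp (-(1 / 25) * k) + Real.exp (-(1 / 25) * k) = 2 * Real.exp (-(1 / 25) * k) := by
          ring
      _ ≤ Real.exp (7 / 800 * k) * Real.exp (-(1 / 25) * k) := by gcongr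
      _ = Real.exp (-k / 32) := by
          rw [← Real.exp_add]
          congr 1
          ring

end RandomRows

section RowPairs

variable {Ω : Type*} [MeasurableSpace Ω] {P : Measure Ω} {n : ℕ}

theorem iIndepFun_curry {ι κ β : Type*} [MeasurableSpace β] {X : ι → κ → Ω → β}
    (hX : ∀ i j, Measurable (X i j)) (h : iIndepFun (fun p : ι × κ => X p.1 p.2) P) :
    iIndepFun (fun i ω j => X i j ω) P := by
  have := h.isProbabilityMeasure
  have (i : ι) (j : κ) : IsProbabilityMeasure (P.map (X i j)) :=
    Measure.isProbabilityMeasure_map (hX i j).aemeasurable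
  have hrow (i : ι) : iIndepFun (X i) P :=
    h.precomp (g := Prod.mk i) (Prod.mk_right_injective i)
  have hsigma : iIndepFun (fun p : (_ : ι) × κ => X p.1 p.2) P :=
    h.precomp (Equiv.sigmaEquivProd ι κ).injective
  have hcurry : (fun ω i j => X i j ω) =
      (MeasurableEquiv.piCurry fun (_ : ι) (_ : κ) => β) ∘ fun ω p => X p.1 p.2 ω := rfl
  rw [iIndepFun_iff_map_fun_eq_infinitePi_map (by fun_prop), hcurry,
    ← Measure.map_map (by fun_prop) (by fun_prop),
    (iIndepFun_iff_map_fun_eq_infinitePi_map (by fun_prop)).1 hsigma,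
    Measure.infinitePi_map_piCurry fun i j => P.map (X i j)]
  congrm Measure.infinitePi fun i => ?_
  rw [(iIndepFun_iff_map_fun_eq_infinitePi_map (by fun_prop)).1 (hrow i)]

theorem integral_sub_sq_of_indepFun {U V : Ω → ℝ} (hU : MemLp U 2 P) (hV : MemLp V 2 P)
    (hind : IndepFun U V P) (hU_mean : ∫ ω, U ω ∂P = 0) :
    ∫ ω, (U ω - V ω) ^ 2 ∂P = ∫ ω, U ω ^ 2 ∂P + ∫ ω, V ω ^ 2 ∂P := by
  have hprod : ∫ ω, U ω * V ω ∂P = 0 := by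
    rw [hind.integral_fun_mul_eq_mul_integral hU.aestronglyMeasurable hV.aestronglyMeasurable,
      hU_mean, zero_mul]
  have hUV : Integrable (fun ω => U ω * V ω) P := hU.integrable_mul hV
  have hsquares : Integrable (fun ω => U ω ^ 2 + V ω ^ 2) P :=
    hU.integrable_sq.add hV.integrable_sq
  have hexpand (ω : Ω) : (U ω - V ω) ^ 2 = U ω ^ 2 + V ω ^ 2 - 2 * (U ω * V ω) := by ring
  simp only [hexpand]
  rw [integral_sub hsquares (hUV.const_mul 2), integral_const_mul, hprod, mul_zero, sub_zero,
    integral_add hU.integrable_sq hV.integrable_sq]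

variable {X Y : Ω → EuclideanSpace ℝ (Fin n)}

theorem IsOneSubgaussian.of_identDistrib (hY : IsOneSubgaussian P Y) (h : IdentDistrib X Y P P) :
    IsOneSubgaussian P X := by
  intro v hv t
  have hexp := h.comp (u := fun x => Real.exp (t * inner ℝ x v)) (by fun_prop)
  exact ⟨hexp.integrable_iff.2 (hY v hv t).1, hexp.integral_eq.trans_le (hY v hv t).2⟩

theorem IsSubIsotropic.of_identDistrib (hY : IsSubIsotropic P Y) (h : IdentDistrib X Y P P) :
    IsSubIsotropic P X := by
  intro v
  have hsq := h.comp (u := fun x => inner ℝ x v ^ 2) (by fun_prop)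
  exact (hY v).trans_eq hsq.integral_eq.symm

theorem IsOneSubgaussian.exists_hasSubgaussianMGF (hX : IsOneSubgaussian P X)
    (v : EuclideanSpace ℝ (Fin n)) : ∃ c, HasSubgaussianMGF (fun ω => inner ℝ (X ω) v) c P := by
  rcases eq_or_ne v 0 with rfl | hv
  · exact ⟨2, hX.hasSubgaussianMGF (by simp)⟩
  have hunit := (hX.hasSubgaussianMGF (norm_smul_inv_norm (𝕜 := ℝ) hv).le).const_mul ‖v‖
  simp only [RCLike.ofReal_real_eq_id, id_eq, inner_smul_right,
    mul_inv_cancel_left₀ (norm_ne_zero_iff.2 hv)] at hunit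
  exact ⟨_, hunit⟩

/-- The difference of two vectors, normalized so that independent copies of a centered random
vector keep their second moments. -/
noncomputable def pairDiff (x y : EuclideanSpace ℝ (Fin n)) : EuclideanSpace ℝ (Fin n) :=
  (√2)⁻¹ • (x - y)

theorem inner_pairDiff (x y v : EuclideanSpace ℝ (Fin n)) :
    inner ℝ (pairDiff x y) v = (√2)⁻¹ * (inner ℝ x v - inner ℝ y v) := by
  rw [pairDiff, real_inner_smul_left, inner_sub_left]

theorem inner_pairDiff_sq (x y v : EuclideanSpace ℝ (Fin n)) :
    inner ℝ (pairDiff x y) v ^ 2 = 1 / 2 * (inner ℝ x v - inner ℝ y v) ^ 2 := by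
  rw [inner_pairDiff, mul_pow, inv_pow, Real.sq_sqrt zero_le_two, one_div]

theorem indepFun_inner_of_indepFun (h : IndepFun X Y P) (v : EuclideanSpace ℝ (Fin n)) :
    IndepFun (fun ω => inner ℝ (X ω) v) (fun ω => inner ℝ (Y ω) v) P :=
  h.comp (φ := fun x => inner ℝ x v) (ψ := fun x => inner ℝ x v) (by fun_prop) (by fun_prop)

theorem IsOneSubgaussian.pairDiff (hX : IsOneSubgaussian P X) (hY : IsOneSubgaussian P Y)
    (h : IndepFun X Y P) : IsOneSubgaussian P fun ω => pairDiff (X ω) (Y ω) := by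
  intro v hv t
  have hv_norm : ‖v‖ ≤ 1 := (sq_le_one_iff₀ (norm_nonneg v)).1 hv
  have hsub := ((hX.hasSubgaussianMGF hv_norm).sub_of_indepFun (hY.hasSubgaussianMGF hv_norm)
    (indepFun_inner_of_indepFun h v)).const_mul (√2)⁻¹
  simp only [inner_pairDiff]
  refine ⟨hsub.integrable_exp_mul t, (hsub.mgf_le t).trans_eq ?_⟩
  congr 1
  change (√2)⁻¹ ^ 2 * ((2 : ℝ) + 2) * t ^ 2 / 2 = t ^ 2
  rw [inv_pow, Real.sq_sqrt zero_le_two]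
  ring

theorem IsSubIsotropic.pairDiff [IsProbabilityMeasure P] (hX : IsSubIsotropic P X)
    (hY : IsSubIsotropic P Y) (hX' : IsOneSubgaussian P X) (hY' : IsOneSubgaussian P Y)
    (h : IndepFun X Y P) : IsSubIsotropic P fun ω => pairDiff (X ω) (Y ω) := by
  intro v
  obtain ⟨c, hXv⟩ := hX'.exists_hasSubgaussianMGF v
  obtain ⟨d, hYv⟩ := hY'.exists_hasSubgaussianMGF v
  simp only [inner_pairDiff_sq]
  rw [integral_const_mul, integral_sub_sq_of_indepFun (hXv.memLp 2) (hYv.memLp 2)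
    (indepFun_inner_of_indepFun h v) (integral_eq_zero_of_hasSubgaussianMGF hXv)]
  linarith [hX v, hY v]

/-- The `m / 2` disjoint pairs `{2 i, 2 i + 1}` of row indices. -/
def pairIndex (m : ℕ) : Fin (m / 2) × Fin 2 ↪ Fin m :=
  finProdFinEquiv.toEmbedding.trans (Fin.castLEEmb (Nat.div_mul_le_self m 2))

/-- The normalized differences of the disjoint pairs of consecutive rows; a bias common to all rows
cancels in them. -/
noncomputable def rowDiff {m : ℕ} (a : Fin m → EuclideanSpace ℝ (Fin n)) (i : Fin (m / 2)) :
    EuclideanSpace ℝ (Fin n) :=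
  pairDiff (a (pairIndex m (i, 0))) (a (pairIndex m (i, 1)))

variable {m : ℕ} {a : Fin m → Ω → EuclideanSpace ℝ (Fin n)}

theorem measurable_rowDiff (ha : ∀ i, Measurable (a i)) (i : Fin (m / 2)) :
    Measurable fun ω => rowDiff (fun l => a l ω) i := by
  simp only [rowDiff, pairDiff]
  fun_prop

theorem iIndepFun_rowDiff (hind : iIndepFun a P) (ha : ∀ i, Measurable (a i)) :
    iIndepFun (fun i ω => rowDiff (fun l => a l ω) i) P :=
  (iIndepFun_curry (X := fun i b => a (pairIndex m (i, b))) (fun _ _ => ha _)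
    (hind.precomp (pairIndex m).injective)).comp (fun _ z => pairDiff (z 0) (z 1)) fun _ => by
      simp only [pairDiff]
      fun_prop

theorem indepFun_pairIndex (hind : iIndepFun a P) (i : Fin (m / 2)) :
    IndepFun (a (pairIndex m (i, 0))) (a (pairIndex m (i, 1))) P :=
  hind.indepFun ((pairIndex m).injective.ne (by simp))

theorem sum_inner_rowDiff_sq_le (b : Fin m → EuclideanSpace ℝ (Fin n))
    (v : EuclideanSpace ℝ (Fin n)) (c : ℝ) :
    ∑ i, inner ℝ (rowDiff b i) v ^ 2 ≤ ∑ i, (inner ℝ (b i) v + c) ^ 2 := by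
  set g : Fin m → ℝ := fun i => inner ℝ (b i) v + c
  calc ∑ i, inner ℝ (rowDiff b i) v ^ 2
      ≤ ∑ i, ∑ l, g (pairIndex m (i, l)) ^ 2 := by
        gcongr with i
        rw [rowDiff, inner_pairDiff_sq, Fin.sum_univ_two]
        linarith [sq_nonneg (g (pairIndex m (i, 0)) + g (pairIndex m (i, 1)))]
    _ = ∑ i ∈ Finset.univ.map (pairIndex m), g i ^ 2 := by
        rw [Finset.sum_map, Fintype.sum_prod_type]
    _ ≤ ∑ i, g i ^ 2 := Finset.sum_le_univ_sum_of_nonneg fun i => sq_nonneg _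

end RowPairs

section BiasedMatrix

variable {m n s : ℕ} {q ρ μ : ℝ}

theorem ellNorm_one_le_of_compl_le {ι : Type*} [Fintype ι] (hq : 2 ≤ q) (hρ : 0 < ρ) (hρ1 : ρ ≤ 1)
    (hs : 0 < s) {S : Finset ι} (hS : S.card ≤ s) {v : ι → ℝ}
    (h : ρ / (s : ℝ) ^ (1 - 1 / q) * ellNorm 1 ((S : Set ι)ᶜ.indicator v) ≤
      ellNorm q ((S : Set ι).indicator v)) :
    ellNorm 1 v ≤ 2 * ((s : ℝ) ^ (1 - 1 / q) / ρ) * ellNorm 2 v := by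
  have hs_pos : (0 : ℝ) < s := Nat.cast_pos.2 hs
  have hq_pos : 0 < q := by linarith
  have hhead : ellNorm 1 ((S : Set ι).indicator v) ≤
      (s : ℝ) ^ (1 - 1 / q) * ellNorm q ((S : Set ι).indicator v) := by
    simpa only [one_div_one] using ellNorm_indicator_le_card one_pos (by linarith) S hS v
  have hq_le_two : ellNorm q ((S : Set ι).indicator v) ≤ ellNorm 2 v :=
    (ellNorm_indicator_le hq_pos _ v).trans (ellNorm_antitone two_pos hq v)
  rw [ellNorm_one_eq_add_compl (S : Set ι) v]
  set r := (s : ℝ) ^ (1 - 1 / q)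
  set x := ellNorm q ((S : Set ι).indicator v)
  have hr : 0 < r := Real.rpow_pos_of_pos hs_pos _
  have htail : ellNorm 1 ((S : Set ι)ᶜ.indicator v) ≤ r / ρ * x := by
    rwa [← inv_div, inv_mul_eq_div, div_le_iff₀ (by positivity), mul_comm] at h
  have hx : 0 ≤ x := ellNorm_nonneg hq_pos _
  have hr_le : r * x ≤ r / ρ * x := by
    gcongr
    exact le_div_self hr.le hρ hρ1
  have : r / ρ * x ≤ r / ρ * ellNorm 2 v := by gcongr
  linarith

theorem nullSpaceProperty_of_lower_bound {A : Matrix (Fin m) (Fin n) ℝ} {c : ℝ} (hq : 2 ≤ q)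
    (hρ : 0 < ρ) (hρ1 : ρ ≤ 1) (hc : 0 < c) (hs : 0 < s)
    (h : ∀ v : Fin n → ℝ, ellNorm 1 v ≤ 2 * ((s : ℝ) ^ (1 - 1 / q) / ρ) * ellNorm 2 v →
      c * ellNorm 2 v ≤ ellNorm 2 (A.mulVec v)) :
    NullSpaceProperty A q s ρ c⁻¹ := by
  intro v S hS
  have hq_pos : 0 < q := by linarith
  have hA := ellNorm_nonneg two_pos (A.mulVec v)
  have hcompl := ellNorm_nonneg one_pos ((S : Set (Fin n))ᶜ.indicator v)
  rcases le_total (ellNorm q ((S : Set (Fin n)).indicator v))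
      (ρ / (s : ℝ) ^ (1 - 1 / q) * ellNorm 1 ((S : Set (Fin n))ᶜ.indicator v)) with hle | hge
  · exact hle.trans (le_add_of_nonneg_right (by positivity))
  · calc ellNorm q ((S : Set (Fin n)).indicator v) ≤ ellNorm 2 v :=
          (ellNorm_indicator_le hq_pos _ v).trans (ellNorm_antitone two_pos hq v)
      _ ≤ c⁻¹ * ellNorm 2 (A.mulVec v) :=
          (le_inv_mul_iff₀ hc).2 (h v (ellNorm_one_le_of_compl_le hq hρ hρ1 hs hS hge))
      _ ≤ _ := le_add_of_nonneg_left (by positivity)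

theorem biasedMatrix_mulVec (a : Fin m → EuclideanSpace ℝ (Fin n)) (μ : ℝ) (v : Fin n → ℝ)
    (i : Fin m) :
    (biasedMatrix a μ).mulVec v i = inner ℝ (a i) (WithLp.toLp 2 v) + μ * ∑ j, v j := by
  simp only [biasedMatrix, Matrix.mulVec, dotProduct, Matrix.of_apply, PiLp.inner_apply,
    RCLike.inner_apply, conj_trivial, Finset.mul_sum, ← Finset.sum_add_distrib]
  exact Finset.sum_congr rfl fun j _ => by ring

theorem norm_toLp_two (v : Fin n → ℝ) : ‖WithLp.toLp 2 v‖ = ellNorm 2 v := by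
  refine (sq_eq_sq₀ (norm_nonneg _) (ellNorm_nonneg two_pos v)).1 ?_
  simp [EuclideanSpace.norm_sq_eq, ellNorm_two_sq]

theorem nullSpaceProperty_biasedMatrix {a : Fin m → EuclideanSpace ℝ (Fin n)} {c : ℝ} (hq : 2 ≤ q)
    (hρ : 0 < ρ) (hρ1 : ρ ≤ 1) (hc : 0 < c) (hs : 0 < s)
    (h : ∀ v : EuclideanSpace ℝ (Fin n),
      (∑ j, |v j|) ^ 2 ≤ 4 * ((s : ℝ) ^ (1 - 1 / q) / ρ) ^ 2 * ‖v‖ ^ 2 →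
        c ^ 2 * ‖v‖ ^ 2 ≤ ∑ i, inner ℝ (rowDiff a i) v ^ 2) :
    NullSpaceProperty (biasedMatrix a μ) q s ρ c⁻¹ := by
  refine nullSpaceProperty_of_lower_bound hq hρ hρ1 hc hs fun v hv => ?_
  refine (sq_le_sq₀ (mul_nonneg hc.le (ellNorm_nonneg two_pos v))
    (ellNorm_nonneg two_pos _)).1 ?_
  calc (c * ellNorm 2 v) ^ 2 = c ^ 2 * ‖WithLp.toLp 2 v‖ ^ 2 := by rw [mul_pow, norm_toLp_two]
    _ ≤ ∑ i, inner ℝ (rowDiff a i) (WithLp.toLp 2 v) ^ 2 := by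
        refine h _ ?_
        calc (∑ j, |v j|) ^ 2 ≤ (2 * ((s : ℝ) ^ (1 - 1 / q) / ρ) * ellNorm 2 v) ^ 2 := by
              rw [ellNorm_one] at hv
              gcongr
          _ = 4 * ((s : ℝ) ^ (1 - 1 / q) / ρ) ^ 2 * ‖WithLp.toLp 2 v‖ ^ 2 := by
              rw [norm_toLp_two]
              ring
    _ ≤ ∑ i, (inner ℝ (a i) (WithLp.toLp 2 v) + μ * ∑ j, v j) ^ 2 :=
        sum_inner_rowDiff_sq_le _ _ _
    _ = ellNorm 2 ((biasedMatrix a μ).mulVec v) ^ 2 := by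
        simp only [ellNorm_two_sq, biasedMatrix_mulVec]

theorem transpose_biasedMatrix_mulVec (hm : m ≠ 0) (hμ : μ ≠ 0)
    (a : Fin m → EuclideanSpace ℝ (Fin n)) (j : Fin n) :
    (biasedMatrix a μ).transpose.mulVec (fun _ => 1 / (m * μ)) j =
      1 + (∑ i, a i j) / (m * μ) := by
  have hm' : (m : ℝ) ≠ 0 := Nat.cast_ne_zero.2 hm
  simp only [biasedMatrix, Matrix.mulVec, dotProduct, Matrix.transpose_apply, Matrix.of_apply,
    ← Finset.sum_mul, Finset.sum_add_distrib, Finset.sum_const, Finset.card_univ,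
    Fintype.card_fin, nsmul_eq_mul]
  field_simp
  ring

theorem ellNorm_two_const (hμ : 0 ≤ μ) :
    ellNorm 2 (fun _ : Fin m => 1 / (m * μ)) = 1 / (√m * μ) := by
  refine (sq_eq_sq₀ (ellNorm_nonneg two_pos _) (by positivity)).1 ?_
  simp only [ellNorm_two_sq, Finset.sum_const, Finset.card_univ, Fintype.card_fin, nsmul_eq_mul,
    div_pow, mul_pow, one_pow, Real.sq_sqrt (Nat.cast_nonneg m)]
  rcases eq_or_ne (m : ℝ) 0 with hm | hm
  · simp [hm]
  · field_simp

theorem abs_transpose_biasedMatrix_mulVec_sub_one_lt (hm : m ≠ 0) (hμ : 0 < μ)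
    {a : Fin m → EuclideanSpace ℝ (Fin n)} {j : Fin n} (h : |∑ i, a i j| < m * μ / 2) :
    |(biasedMatrix a μ).transpose.mulVec (fun _ => 1 / (m * μ)) j - 1| < 1 / 2 := by
  have hmμ : 0 < m * μ := mul_pos (Nat.cast_pos.2 (Nat.pos_of_ne_zero hm)) hμ
  rw [transpose_biasedMatrix_mulVec hm hμ.ne', add_sub_cancel_left, abs_div, abs_of_pos hmμ,
    div_lt_iff₀ hmμ]
  linarith

theorem norm_lt_of_abs_sub_one_lt {d : Fin n → ℝ} (hd : ∀ j, |d j - 1| < 1 / 2) :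
    ‖d‖ < 3 / 2 := by
  refine (pi_norm_lt_iff (by norm_num)).2 fun j => ?_
  rw [Real.norm_eq_abs, abs_lt]
  constructor <;> linarith [abs_lt.1 (hd j)]

theorem norm_inv_lt_of_abs_sub_one_lt {d : Fin n → ℝ} (hd : ∀ j, |d j - 1| < 1 / 2) :
    ‖d⁻¹‖ < 2 := by
  refine (pi_norm_lt_iff two_pos).2 fun j => ?_
  have hj : 1 / 2 < d j := by linarith [abs_lt.1 (hd j)]
  rw [Pi.inv_apply, norm_inv, Real.norm_eq_abs, abs_of_pos (by linarith)]
  exact inv_lt_of_inv_lt₀ two_pos (by simpa using hj)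

theorem pos_and_condNumber_lt_and_specNorm_inv_lt {A : Matrix (Fin m) (Fin n) ℝ} {t : Fin m → ℝ}
    (hd : ∀ j, |A.transpose.mulVec t j - 1| < 1 / 2) :
    (∀ j, 0 < A.transpose.mulVec t j) ∧ condNumber A t < 3 ∧ specNorm (weight A t)⁻¹ < 2 := by
  have hpos (j : Fin n) : 0 < A.transpose.mulVec t j := by linarith [abs_lt.1 (hd j)]
  have hne (j : Fin n) := (hpos j).ne'
  refine ⟨hpos, ?_, ?_⟩
  · rw [condNumber_eq hne]
    calc _ < (3 / 2 : ℝ) * 2 := mul_lt_mul'' (norm_lt_of_abs_sub_one_lt hd)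
          (norm_inv_lt_of_abs_sub_one_lt hd) (norm_nonneg _) (norm_nonneg _)
      _ = 3 := by norm_num
  · rw [weight, specNorm_inv_diagonal hne]
    exact norm_inv_lt_of_abs_sub_one_lt hd

variable {Ω : Type*} [MeasurableSpace Ω] {P : Measure Ω}
  {a : Fin m → Ω → EuclideanSpace ℝ (Fin n)}

theorem measure_not_forall_abs_weight_sub_one_lt_le (hind : iIndepFun a P)
    (hsg : ∀ i, IsOneSubgaussian P (a i)) (hm : m ≠ 0) (hμ : 0 < μ) :
    P.real {ω | ¬∀ j, |(biasedMatrix (fun i => a i ω) μ).transpose.mulVec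
      (fun _ => 1 / (m * μ)) j - 1| < 1 / 2} ≤ 2 * n * Real.exp (-(μ ^ 2 * m) / 16) := by
  have := hind.isProbabilityMeasure
  have hm' : (m : ℝ) ≠ 0 := Nat.cast_ne_zero.2 hm
  have hsum := measureReal_exists_le fun j =>
    measure_ge_abs_sum_coord_le hind hsg j (ε := m * μ / 2) (by positivity)
  have hexponent : -((m * μ / 2) ^ 2 / (4 * m)) = -(μ ^ 2 * m) / 16 := by
    field_simp
    norm_num
  simp only [Fintype.card_fin, hexponent] at hsum
  refine (measureReal_mono fun ω hω => ?_).trans (hsum.trans_eq (by ring))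
  by_contra hlt
  simp only [Set.mem_ofPred_eq, not_exists, not_le] at hlt
  exact hω fun j => abs_transpose_biasedMatrix_mulVec_sub_one_lt hm hμ (hlt j)

theorem natCast_le_sq_rpow_div (hq : 2 ≤ q) (hρ : 0 < ρ) (hρ1 : ρ ≤ 1) (hs : 0 < s) :
    (s : ℝ) ≤ ((s : ℝ) ^ (1 - 1 / q) / ρ) ^ 2 := by
  have hs_one : (1 : ℝ) ≤ s := Nat.one_le_cast.2 hs
  have hexponent : 1 ≤ (1 - 1 / q) * (2 : ℕ) := by
    have : 1 / q ≤ 1 / 2 := one_div_le_one_div_of_le two_pos hq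
    push_cast
    linarith
  calc (s : ℝ) = (s : ℝ) ^ (1 : ℝ) := (Real.rpow_one _).symm
    _ ≤ (s : ℝ) ^ ((1 - 1 / q) * (2 : ℕ)) := Real.rpow_le_rpow_of_exponent_le hs_one hexponent
    _ = ((s : ℝ) ^ (1 - 1 / q)) ^ 2 := Real.rpow_mul_natCast (Nat.cast_nonneg s) _ _
    _ ≤ ((s : ℝ) ^ (1 - 1 / q) / ρ) ^ 2 := by
        gcongr
        exact le_div_self (by positivity) hρ hρ1

theorem one_lt_of_sample_bound (hρ : 0 < ρ) (hs : 0 < s)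
    (hm : 2 * 384 ^ 2 / ρ ^ 2 * (s : ℝ) ^ (2 - 2 / q)
      * (2 + √(Real.log (Real.exp 1 * n / s))) ^ 2 + 1 ≤ m) : (1 : ℝ) < m := by
  have : (0 : ℝ) < s := Nat.cast_pos.2 hs
  exact (lt_add_of_pos_left 1 (by positivity)).trans_le hm

theorem measure_not_nullSpaceProperty_biasedMatrix_le (hind : iIndepFun a P)
    (ha : ∀ i, Measurable (a i)) (hsg : ∀ i, IsOneSubgaussian P (a i))
    (hiso : ∀ i, IsSubIsotropic P (a i)) (hq : 2 ≤ q) (hρ : 0 < ρ) (hρ1 : ρ ≤ 1) (hs : 0 < s)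
    (hsn : s ≤ n)
    (hm : 2 * 384 ^ 2 / ρ ^ 2 * (s : ℝ) ^ (2 - 2 / q)
      * (2 + √(Real.log (Real.exp 1 * n / s))) ^ 2 + 1 ≤ m) (μ : ℝ) :
    P.real {ω | ¬NullSpaceProperty (biasedMatrix (fun i => a i ω) μ) q s ρ (√(m - 1) / 16)⁻¹} ≤
      Real.exp (-((m : ℝ) - 1) / 64) := by
  have := hind.isProbabilityMeasure
  have hm_pos : 0 < (m : ℝ) - 1 := sub_pos.2 (one_lt_of_sample_bound hρ hs hm)
  have hhalf : ((m : ℝ) - 1) / 2 ≤ Fintype.card (Fin (m / 2)) := by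
    have : (m : ℝ) ≤ 2 * (m / 2 : ℕ) + 1 := by exact_mod_cast (by omega : m ≤ 2 * (m / 2) + 1)
    rw [Fintype.card_fin]
    linarith
  have hsquare : (s : ℝ) ^ (2 - 2 / q) = ((s : ℝ) ^ (1 - 1 / q)) ^ 2 := by
    rw [← Real.rpow_mul_natCast (Nat.cast_nonneg s)]
    congr 1
    push_cast
    ring
  have hsample : 384 ^ 2 * ((s : ℝ) ^ (1 - 1 / q) / ρ) ^ 2
      * (2 + √(Real.log (Real.exp 1 * n / s))) ^ 2 ≤ Fintype.card (Fin (m / 2)) := by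
    refine le_trans ?_ hhalf
    rw [le_div_iff₀ two_pos, le_sub_iff_add_le]
    refine le_of_eq_of_le ?_ hm
    rw [hsquare]
    ring
  have hrows := measure_exists_sum_inner_sq_lt_le (iIndepFun_rowDiff hind ha)
    (measurable_rowDiff ha) (fun i => (hsg _).pairDiff (hsg _) (indepFun_pairIndex hind i))
    (fun i => (hiso _).pairDiff (hiso _) (hsg _) (hsg _) (indepFun_pairIndex hind i)) hs hsn
    (natCast_le_sq_rpow_div hq hρ hρ1 hs) hsample
  refine (measureReal_mono fun ω hω => ?_).trans
    (hrows.trans (Real.exp_le_exp.2 (by linarith)))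
  by_contra hgood
  simp only [Set.mem_ofPred_eq, not_exists, not_and, not_lt] at hgood
  refine hω (nullSpaceProperty_biasedMatrix hq hρ hρ1 (by positivity) hs fun v hv => ?_)
  refine (mul_le_mul_of_nonneg_right ?_ (sq_nonneg _)).trans (hgood v hv)
  rw [div_pow, Real.sq_sqrt hm_pos.le]
  linarith

theorem measureReal_not_and_le {p q : Ω → Prop} {ε δ : ℝ} (hp : P.real {ω | ¬p ω} ≤ ε)
    (hq : P.real {ω | ¬q ω} ≤ δ) : P.real {ω | ¬(p ω ∧ q ω)} ≤ ε + δ := by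
  simp only [not_and_or, Set.ofPred_or]
  exact (measureReal_union_le _ _).trans (add_le_add hp hq)

theorem exists_measurableSet_forall_of_measureReal_le [IsProbabilityMeasure P] {p : Ω → Prop}
    {ε : ℝ} (h : P.real {ω | ¬p ω} ≤ ε) :
    ∃ E, MeasurableSet E ∧ 1 - ε ≤ P.real E ∧ ∀ ω ∈ E, p ω := by
  refine ⟨(toMeasurable P {ω | ¬p ω})ᶜ, (measurableSet_toMeasurable _ _).compl, ?_, fun ω hω => ?_⟩
  · rw [probReal_compl_eq_one_sub (measurableSet_toMeasurable _ _), measureReal_def,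
      measure_toMeasurable]
    exact sub_le_sub_left h 1
  · by_contra hp
    exact hω (subset_toMeasurable _ _ hp)

end BiasedMatrix

end BiasedNNLS

theorem theorem4_general (ρ q : ℝ) (hρ0 : 0 < ρ) (hρ1 : ρ < 1 / 3) (hq : 2 ≤ q)
    (m n s : ℕ) (hs : 1 ≤ s) (hsn : s ≤ n)
    (hm : 2 * 384 ^ 2 / ρ ^ 2 * (s : ℝ) ^ (2 - 2 / q)
        * (2 + Real.sqrt (Real.log (Real.exp 1 * n / s))) ^ 2 + 1 ≤ (m : ℝ)) :
    ∃ τ : ℝ, 0 < τ ∧ 1 / τ = Real.sqrt ((m : ℝ) - 1) / 16 ∧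
      ∀ (Ω : Type*) [MeasurableSpace Ω] (P : Measure Ω) [IsProbabilityMeasure P]
        (μ : ℝ) (a : Fin m → Ω → EuclideanSpace ℝ (Fin n)),
        0 < μ →
        (∀ i, Measurable (a i)) →
        iIndepFun a P →
        (∀ i, IsSubIsotropic P (a i)) →
        (∀ i, IsOneSubgaussian P (a i)) →
        ∃ E : Set Ω, MeasurableSet E ∧
          1 - Real.exp (-((m : ℝ) - 1) / 64) - 2 * n * Real.exp (-(μ ^ 2 * m) / 16) ≤ P.real E ∧
          ∀ ω ∈ E,
            let A : Matrix (Fin m) (Fin n) ℝ := biasedMatrix (fun i => a i ω) μ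
            let t : Fin m → ℝ := fun _ => 1 / (m * μ)
            let κ : ℝ := condNumber A t
            let w : ℝ := specNorm (weight A t)⁻¹
            NullSpaceProperty A q s ρ τ ∧
            (∀ j, 0 < A.transpose.mulVec t j) ∧ κ < 3 ∧ w < 2 ∧
            ∀ p : ℝ, 1 ≤ p → p ≤ q →
              ∀ x₀ : Fin n → ℝ, (∀ j, 0 ≤ x₀ j) → ∀ (z : Fin m → ℝ) (x : Fin n → ℝ),
                IsNNLSSolution A (A.mulVec x₀ + z) x →
                ellNorm p (x - x₀) ≤
                  constC κ ρ / (s : ℝ) ^ (1 - 1 / p) * bestApproxError s 1 x₀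
                    + constD κ ρ w / (s : ℝ) ^ (1 / q - 1 / p)
                        * (1 / (Real.sqrt m * μ) + τ) * ellNorm 2 z := by
  have hm_one := one_lt_of_sample_bound hρ0 hs hm
  have : 0 < (m : ℝ) - 1 := sub_pos.2 hm_one
  have hm_ne : m ≠ 0 := Nat.cast_ne_zero.1 (zero_lt_one.trans hm_one).ne'
  refine ⟨(√(m - 1) / 16)⁻¹, by positivity, by rw [one_div, inv_inv],
    fun Ω _ P _ μ a hμ ha hind hiso hsg => ?_⟩
  have hnsp := measure_not_nullSpaceProperty_biasedMatrix_le hind ha hsg hiso hq hρ0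
    (by linarith) hs hsn hm μ
  have hweights := measure_not_forall_abs_weight_sub_one_lt_le hind hsg hm_ne hμ
  obtain ⟨E, hE, hPE, hgood⟩ := exists_measurableSet_forall_of_measureReal_le
    (measureReal_not_and_le hnsp hweights)
  refine ⟨E, hE, by rwa [sub_sub], fun ω hω => ?_⟩
  intro A t κ w
  obtain ⟨hA, hd⟩ := hgood ω hω
  obtain ⟨hpos, hκ, hw⟩ := pos_and_condNumber_lt_and_specNorm_inv_lt hd
  refine ⟨hA, hpos, hκ, hw, fun p hp hpq x₀ hx₀ z x hx => ?_⟩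
  have hκρ : κ * ρ < 1 := by nlinarith
  have herror := hA.nnls_error_le hpos hρ0.le hκρ (by positivity) hs hsn hp hpq hx₀ hx
  rwa [add_sub_cancel_left, ellNorm_two_const hμ.le] at herror

theorem theorem4 (ρ q : ℝ) (hρ0 : 0 < ρ) (hρ1 : ρ < 1 / 3) (hq : 2 ≤ q)
    (m n s : ℕ) (hs : 1 ≤ s) (hsn : s ≤ n)
    (hm : 2 * 384 ^ 2 / ρ ^ 2 * (s : ℝ) ^ (2 - 2 / q)
        * (2 + Real.sqrt (Real.log (Real.exp 1 * n / s))) ^ 2 + 1 ≤ (m : ℝ)) :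
    ∃ τ : ℝ, 0 < τ ∧
      Real.sqrt ((m : ℝ) - 1) / 16
          - 3 * (s : ℝ) ^ (1 - 1 / q) / ρ * (8 * Real.sqrt 2)
              * (2 + Real.sqrt (Real.log (Real.exp 1 * n / s))) ≤ 1 / τ ∧
      ∀ (Ω : Type*) [MeasurableSpace Ω] (P : Measure Ω) [IsProbabilityMeasure P]
        (μ : ℝ) (a₀ : Ω → EuclideanSpace ℝ (Fin n)) (a : Fin m → Ω → EuclideanSpace ℝ (Fin n)),
        0 < μ →
        (∀ i, Measurable (a i)) →
        iIndepFun a P →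
        (∀ i, IdentDistrib (a i) a₀ P P) →
        IsSubIsotropic P a₀ →
        IsOneSubgaussian P a₀ →
        (∀ j : Fin n, IsOneSubgaussian P (fun ω => column (fun i => a i ω) j)) →
        ∃ E : Set Ω, MeasurableSet E ∧
          1 - Real.exp (-((m : ℝ) - 1) / 64) - 2 * n * Real.exp (-(μ ^ 2 * m) / 16) ≤ P.real E ∧
          ∀ ω ∈ E,
            let A : Matrix (Fin m) (Fin n) ℝ := biasedMatrix (fun i => a i ω) μ
            let t : Fin m → ℝ := fun _ => 1 / (m * μ)
            let κ : ℝ := condNumber A t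
            let w : ℝ := specNorm (weight A t)⁻¹
            NullSpaceProperty A q s ρ τ ∧
            (∀ j, 0 < A.transpose.mulVec t j) ∧ κ < 3 ∧ w < 2 ∧
            ∀ p : ℝ, 1 ≤ p → p ≤ q →
              ∀ x₀ : Fin n → ℝ, (∀ j, 0 ≤ x₀ j) → ∀ (z : Fin m → ℝ) (x : Fin n → ℝ),
                IsNNLSSolution A (A.mulVec x₀ + z) x →
                ellNorm p (x - x₀) ≤
                  constC κ ρ / (s : ℝ) ^ (1 - 1 / p) * bestApproxError s 1 x₀
                    + constD κ ρ w / (s : ℝ) ^ (1 / q - 1 / p)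
                        * (1 / (Real.sqrt m * μ) + τ) * ellNorm 2 z := by
  obtain ⟨τ, hτ, hτ_eq, hrecovery⟩ := theorem4_general ρ q hρ0 hρ1 hq m n s hs hsn hm
  exact ⟨τ, hτ, (sub_le_self _ (by positivity)).trans hτ_eq.ge,
    fun Ω _ P _ μ _ a hμ ha hind hid hiso hsg _ =>
      hrecovery Ω P μ a hμ ha hind (fun i => hiso.of_identDistrib (hid i))
        fun i => hsg.of_identDistrib (hid i)⟩
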